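/- **Lemma (stability of the non-conservative ALE-SUPG scheme with the implicit Euler method).** *Setting.* Let $d\in\{2,3\}$, $T>0$, $N\ge 1$, $\Delta t=T/N$, $t^n=n\Delta t$, $\epsilon>0$. Let $\hat{\mathcal T}$ be a finite conforming triangulation into $d$-simplices of a closed polyhedral reference domain $\overline{\hat\Omega}$, and for $0\le n\le N$ let $\mathcal A_{t^n}:\overline{\hat\Omega}\to\mathbb R^d$ be continuous and affine on every cell. For $t\in[t^n,t^{n+1}]$, $n<N$, put $$\mathcal A_{h,\Delta t}(t)=\tfrac{t-t^n}{\Delta t}\mathcal A_{t^{n+1}}+\tfrac{t^{n+1}-t}{\Delta t}\mathcal A_{t^n},$$ assume that this map is injective on $\overline{\hat\Omega}$ for every such $t$, and let $\Omega_t$ be the interior of its image; $\mathcal T_{t^n}$ is the image mesh of $\Omega_{t^n}$, with cells $K$ of diameter $h_K$. The mesh velocity on $\Omega_t$, $t\in(t^n,t^{n+1}]$, is $$\mathbf w_h(t)=\frac{\mathcal A_{t^{n+1}}-\mathcal A_{t^n}}{\Delta t}\circ\mathcal A_{h,\Delta t}(t)^{-1},\qquad \mathbf w_h^{n+1}=\mathbf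 w_h(t^{n+1}).$$ Write $\mathcal A_{t^m,t^n}=\mathcal A_{t^n}\circ\mathcal A_{t^m}^{-1}$, and let $J_{\mathcal A_{t^n,t^{n+1}}}$ be the Jacobian determinant of $\mathcal A_{t^n,t^{n+1}}$. Let $V_h^n$ be the space of $v\in C(\overline{\Omega_{t^n}})$ with $v=0$ on $\partial\Omega_{t^n}$ and $v|_K$ a polynomial of degree at most $k$ for every $K\in\mathcal T_{t^n}$. For $1\le n\le N$, let $\mathbf b=\mathbf b(t^n,\cdot)$ be Lipschitz on $\Omega_{t^n}$, $c=c(t^n,\cdot)\in L^\infty(\Omega_{t^n})$ and $f^n=f(t^n,\cdot)\in L^2(\Omega_{t^n})$, and let $\delta_K\ge 0$ for $K\in\mathcal T_{t^n}$. *Scheme.* Let $u_h^n\in V_h^n$ $(0\le n\le N)$ satisfy, for all $0\le n<N$ and all $v\in V_h^{n+1}$, $$\Big(\frac{u_h^{n+1}-u_h^n\circ\mathcal A_{t^{n+1},t^n}}{\Delta t},v\Big)_{\Omega_{t^{n+1}}}+a^{n+1}_{SUPG}(u_h^{n+1},v)-\int_{\Omega_{t^{n+1}}}\mathbf w_h^{n+1}\cdot\nabla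 u_h^{n+1}\,v\,dx=\int_{\Omega_{t^{n+1}}}f^{n+1}v\,dx+\sum_{K\in\mathcal T_{t^{n+1}}}\delta_K\int_K f^{n+1}(\mathbf b-\mathbf w_h^{n+1})\cdot\nabla v\,dx,$$ where, for $n\ge1$, $$a^{n}_{SUPG}(u,v)=\epsilon(\nabla u,\nabla v)_{\Omega_{t^n}}+(\mathbf b\cdot\nabla u,v)_{\Omega_{t^n}}+(cu,v)_{\Omega_{t^n}}+\sum_{K\in\mathcal T_{t^n}}\delta_K\big(-\epsilon\Delta u+(\mathbf b-\mathbf w_h^n)\cdot\nabla u+cu,\ (\mathbf b-\mathbf w_h^n)\cdot\nabla v\big)_K .$$ *Assumptions.* Let $\mu>0$ and let $c_{inv}>0$ be a constant in the inverse inequality $\|\Delta v\|_{L^2(K)}\le c_{inv}h_K^{-1}\|\nabla v\|_{L^2(K)}$ $(v\in V_h^n,\ K\in\mathcal T_{t^n},\ 1\le n\le N)$. Assume that for $1\le n\le N$ $$c-\tfrac12\nabla\cdot\mathbf b\ge\mu\ \text{ a.e. in }\Omega_{t^n},\qquad \delta_K\le\frac{\mu}{2\|c\|_{L^\infty(K)}^2},\quad\delta_K\le\frac{h_K^2}{2\epsilon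 c_{inv}^2},\quad\delta_K\le\frac{\Delta t}{4}\qquad(K\in\mathcal T_{t^n})$$ (the first bound on $\delta_K$ being void if $c=0$ on $K$). Put $$|||v|||^2=\epsilon\|\nabla v\|_{L^2(\Omega_{t^n})}^2+\sum_{K\in\mathcal T_{t^n}}\delta_K\|(\mathbf b-\mathbf w_h^n)\cdot\nabla v\|_{L^2(K)}^2+\mu\|v\|_{L^2(\Omega_{t^n})}^2\qquad(v\in V_h^n,\ n\ge1),$$ $$\alpha_1^n=\|\nabla\cdot\mathbf w_h^n\|_{L^\infty(\Omega_{t^n})}\ (1\le n\le N),\qquad \alpha_2^n=\sup_{t\in(t^n,t^{n+1})}\|J_{\mathcal A_{t^n,t^{n+1}}}\,\nabla\cdot\mathbf w_h(t)\|_{L^\infty(\Omega_t)}\ (0\le n<N),\qquad\alpha_2^N=0,$$ where $J_{\mathcal A_{t^n,t^{n+1}}}$ is regarded as a function on $\Omega_t$ through the ALE mapping. *Conclusion.* Let $0\le n<N$ and $\Delta t(\alpha_1^i+\alpha_2^i)<1$ for $1\le i\le n+1$. Then $$\|u_h^{n+1}\|^2_{L^2(\Omega_{t^{n+1}})}+\frac{\Delta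 t}{2}\sum_{i=1}^{n+1}|||u_h^i|||^2\le\Big[(1+\Delta t\,\alpha_2^0)\|u_h^0\|^2_{L^2(\Omega_{t^0})}+\Delta t\sum_{i=1}^{n+1}\Big(\frac2\mu+\frac{\Delta t}{2}\Big)\|f^i\|^2_{L^2(\Omega_{t^i})}\Big]\exp\Big(\Delta t\sum_{i=1}^{n+1}\frac{\alpha_1^i+\alpha_2^i}{1-\Delta t(\alpha_1^i+\alpha_2^i)}\Big).$$ -/

import Mathlib

open MeasureTheory Set
open scoped ENNReal

noncomputable section

namespace ALESUPG

/-- The Euclidean space `ℝ^d`. -/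
abbrev E (d : ℕ) : Type := EuclideanSpace ℝ (Fin d)

/-- A finite conforming triangulation into nondegenerate `d`-simplices: a finite simplicial complex
in `ℝ^d`, each of whose faces is a face of a `d`-simplex of the complex. -/
structure Triangulation (d : ℕ) extends Geometry.SimplicialComplex ℝ (E d) where
  finite_faces : faces.Finite
  pure_faces : ∀ s ∈ faces, ∃ σ ∈ faces, s ⊆ σ ∧ σ.card = d + 1

/-- The cells (`d`-simplices) of a triangulation, each given by its set of vertices. -/
def Triangulation.cells {d : ℕ} (M : Triangulation d) : Finset (Finset (E d)) :=
  (M.finite_faces.subset (Set.sep_subset M.faces fun σ => σ.card = d + 1)).toFinset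

/-- The closed polyhedron covered by the triangulation. -/
abbrev Triangulation.region {d : ℕ} (M : Triangulation d) : Set (E d) :=
  M.toSimplicialComplex.space

/-- Membership in the vector-valued Lagrange space of degree one: continuous on the triangulated
region and affine on every cell. -/
def Triangulation.IsP1Map {d : ℕ} (M : Triangulation d) (φ : E d → E d) : Prop :=
  ContinuousOn φ M.region ∧
    ∀ σ ∈ M.cells, ∃ g : E d →ᵃ[ℝ] E d, EqOn φ g (convexHull ℝ (σ : Set (E d)))

/-- The divergence `∑ i, ∂F_i/∂x_i`. -/
def divergence {d : ℕ} (F : E d → E d) (x : E d) : ℝ :=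
  ∑ i : Fin d, (fderiv ℝ F x (EuclideanSpace.single i 1)) i

/-- The `L^∞` norm on a set. -/
def linfty {d : ℕ} (s : Set (E d)) (g : E d → ℝ) : ℝ≥0∞ :=
  eLpNorm g ∞ (volume.restrict s)

/-- The squared `L²` norm on a set. -/
def l2sq {d : ℕ} (s : Set (E d)) (g : E d → ℝ) : ℝ :=
  ∫ x in s, g x ^ 2

/-- The data of the fully discrete scheme; the assumptions on them are hypotheses of the theorem. -/
structure Scheme (d : ℕ) where
  /-- the triangulation of the reference domain -/
  mesh : Triangulation d
  /-- the polynomial degree of the finite element space -/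
  k : ℕ
  /-- the end time -/
  T : ℝ
  /-- the number of time steps -/
  N : ℕ
  /-- the semidiscrete ALE mapping `A t Y` -/
  A : ℝ → E d → E d
  /-- the diffusivity -/
  eps : ℝ
  /-- the convective velocity `b t x` -/
  b : ℝ → E d → E d
  /-- the reaction coefficient `c t x` -/
  c : ℝ → E d → ℝ
  /-- the source term `f t x` -/
  f : ℝ → E d → ℝ
  /-- the stabilization parameter at a time level on the image of a reference cell -/
  δ : ℕ → Finset (E d) → ℝ

namespace Scheme

variable {d : ℕ} (S : Scheme d)

/-- The time step `Δt = T / N`. -/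
def dt : ℝ := S.T / S.N

/-- The time levels `t^n = n Δt`. -/
def time (n : ℕ) : ℝ := n * S.dt

/-- The discrete ALE mapping at a time `t ∈ [t^n, t^{n+1}]`: linear interpolation in time. -/
def interp (n : ℕ) (t : ℝ) (Y : E d) : E d :=
  ((t - S.time n) / S.dt) • S.A (S.time (n + 1)) Y +
    ((S.time (n + 1) - t) / S.dt) • S.A (S.time n) Y

/-- The inverse of the discrete ALE mapping at a time `t ∈ [t^n, t^{n+1}]`. -/
def interpInv (n : ℕ) (t : ℝ) : E d → E d :=
  Function.invFunOn (S.interp n t) S.mesh.region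

/-- The domain `Ω_t` for `t ∈ [t^n, t^{n+1}]`. -/
def domAt (n : ℕ) (t : ℝ) : Set (E d) := interior (S.interp n t '' S.mesh.region)

/-- The closure of the domain `Ω_{t^n}`. -/
def closedDom (n : ℕ) : Set (E d) := S.A (S.time n) '' S.mesh.region

/-- The domain `Ω_{t^n}`. -/
def dom (n : ℕ) : Set (E d) := interior (S.closedDom n)

/-- The cell `K` of the mesh at time `t^n` that corresponds to the reference cell `σ`. -/
def cell (n : ℕ) (σ : Finset (E d)) : Set (E d) :=
  S.A (S.time n) '' convexHull ℝ (σ : Set (E d))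

/-- The ALE mapping `A_{t^m, t^n} = A_{t^n} ∘ A_{t^m}⁻¹` between two time levels. -/
def transfer (m n : ℕ) (x : E d) : E d :=
  S.A (S.time n) (Function.invFunOn (S.A (S.time m)) S.mesh.region x)

/-- The Jacobian determinant of `A_{t^n, t^{n+1}}`, a function on `Ω_{t^n}`. -/
def jac (n : ℕ) (x : E d) : ℝ := (fderiv ℝ (S.transfer n (n + 1)) x).det

/-- The mesh velocity `(A_{t^{n+1}}(Y) - A_{t^n}(Y)) / Δt` of the step from `t^n` to `t^{n+1}`,
as a function of `x ∈ Ω_t`, for `t ∈ [t^n, t^{n+1}]`. -/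
def meshVel (n : ℕ) (t : ℝ) (x : E d) : E d :=
  (S.dt)⁻¹ • (S.A (S.time (n + 1)) (S.interpInv n t x) - S.A (S.time n) (S.interpInv n t x))

/-- The mesh velocity `w_h^n` on `Ω_{t^n}`, `n ≥ 1`, that of the step from `t^{n-1}` to `t^n`. -/
def w (n : ℕ) : E d → E d := S.meshVel (n - 1) (S.time n)

/-- The relative convective velocity `b - w_h^n` at time `t^n`, `n ≥ 1`. -/
def relVel (n : ℕ) (x : E d) : E d := S.b (S.time n) x - S.w n x

/-- The finite element space `V_h` on `Ω_{t^n}`: continuous on the closed domain, zero on the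
boundary, a polynomial of degree at most `k` on every cell. -/
def InVh (n : ℕ) (v : E d → ℝ) : Prop :=
  ContinuousOn v (S.closedDom n) ∧
    (∀ x ∈ frontier (S.closedDom n), v x = 0) ∧
    ∀ σ ∈ S.mesh.cells, ∃ p : MvPolynomial (Fin d) ℝ, p.totalDegree ≤ S.k ∧
      ∀ x ∈ S.cell n σ, v x = MvPolynomial.eval (fun i => x i) p

/-- The bilinear form `a_SUPG^n`, `n ≥ 1`. -/
def aSUPG (n : ℕ) (u v : E d → ℝ) : ℝ :=
  S.eps * (∫ x in S.dom n, inner ℝ (gradient u x) (gradient v x)) +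
    (∫ x in S.dom n, inner ℝ (S.b (S.time n) x) (gradient u x) * v x) +
    (∫ x in S.dom n, S.c (S.time n) x * u x * v x) +
    ∑ σ ∈ S.mesh.cells, S.δ n σ * ∫ x in S.cell n σ,
      (-S.eps * Laplacian.laplacian u x + inner ℝ (S.relVel n x) (gradient u x) +
        S.c (S.time n) x * u x) * inner ℝ (S.relVel n x) (gradient v x)

/-- `u n ∈ V_h`, `n = 0, …, N`, is a solution of the non-conservative ALE-SUPG scheme with the
implicit Euler method. -/
def IsSolution (u : ℕ → E d → ℝ) : Prop :=
  (∀ n ≤ S.N, S.InVh n (u n)) ∧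
    ∀ n < S.N, ∀ v : E d → ℝ, S.InVh (n + 1) v →
      (∫ x in S.dom (n + 1), (u (n + 1) x - u n (S.transfer (n + 1) n x)) / S.dt * v x) +
          S.aSUPG (n + 1) (u (n + 1)) v -
          (∫ x in S.dom (n + 1), inner ℝ (S.w (n + 1) x) (gradient (u (n + 1)) x) * v x) =
        (∫ x in S.dom (n + 1), S.f (S.time (n + 1)) x * v x) +
          ∑ σ ∈ S.mesh.cells, S.δ (n + 1) σ * ∫ x in S.cell (n + 1) σ,
            S.f (S.time (n + 1)) x * inner ℝ (S.relVel (n + 1) x) (gradient v x)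

/-- The squared mesh-dependent norm `|||v|||²` at time `t^n`, `n ≥ 1`. -/
def supgNormSq (μ : ℝ) (n : ℕ) (v : E d → ℝ) : ℝ :=
  S.eps * (∫ x in S.dom n, ‖gradient v x‖ ^ 2) +
    (∑ σ ∈ S.mesh.cells,
      S.δ n σ * l2sq (S.cell n σ) (fun x => inner ℝ (S.relVel n x) (gradient v x))) +
    μ * l2sq (S.dom n) v

/-- `C` is a constant in the inverse inequality `‖Δ v_h‖_{0,K} ≤ C h_K⁻¹ |v_h|_{1,K}` on the finite
element spaces at the times `t^1, …, t^N`. -/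
def IsInverseConst (C : ℝ) : Prop :=
  0 < C ∧ ∀ n ∈ Finset.Icc 1 S.N, ∀ σ ∈ S.mesh.cells, ∀ v : E d → ℝ, S.InVh n v →
    Real.sqrt (l2sq (S.cell n σ) (Laplacian.laplacian v)) ≤
      C * (Metric.diam (S.cell n σ))⁻¹ * Real.sqrt (∫ x in S.cell n σ, ‖gradient v x‖ ^ 2)

/-- `α₁^n`, `n ≥ 1`: the `L^∞` norm of `∇ · w_h^n` on `Ω_{t^n}`. -/
def alpha1 (n : ℕ) : ℝ := (linfty (S.dom n) (divergence (S.w n))).toReal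

/-- `α₂^n`: the supremum over `t ∈ (t^n, t^{n+1})` of the `L^∞(Ω_t)` norm of `∇ · w_h` multiplied by
the Jacobian of `A_{t^n, t^{n+1}}`, carried to `Ω_t` by the ALE mapping. No step starts at `t^N`,
and `α₂^N = 0`. -/
def alpha2 (n : ℕ) : ℝ :=
  if n < S.N then
    (⨆ t ∈ Ioo (S.time n) (S.time (n + 1)),
      linfty (S.domAt n t) (fun x =>
        S.jac n (S.A (S.time n) (S.interpInv n t x)) * divergence (S.meshVel n t) x)).toReal
  else 0

end Scheme

end ALESUPG

end

/-!
The scheme is tested with `v = u^{n+1}`. The function `v² (b - w)` vanishes on the boundary, so the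
divergence theorem turns the convection by `b - w` into `-1/2 ∫ ∇ · (b - w) v²`; together with the
reaction term this is coercive with constant `μ`, up to `α₁ / 2` for the compressibility of the
mesh. The stabilization terms are absorbed by Young's inequality, the inverse inequality and the
bounds on `δ_K`.

The function `u^n` lives on the previous domain, and transferring it multiplies the square of its
`L²` norm by at most the largest cell Jacobian `J` of the step. On a cell the derivative of the ALE
mapping moves along a segment of matrices, where the logarithmic derivative of the determinant is
`Δt ∇ · w_h`. The mean value theorem gives `log J = Δt ∇ · w_h(t)` for some `t`, hence
`J - 1 ≤ J log J ≤ Δt α₂^n`. A discrete Gronwall inequality, implicit in the new value, sums the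
steps.
-/

open Filter Topology
open scoped NNReal

namespace ALESUPG

/-! ### Families of convex cells -/

section Cells

theorem interior_subset_interior_biUnion {ι X : Type*} [TopologicalSpace X] {s : Finset ι}
    {K : ι → Set X} {i : ι} (hi : i ∈ s) : interior (K i) ⊆ interior (⋃ i ∈ s, K i) :=
  interior_mono (subset_biUnion_of_mem (u := K) hi)

variable {ι V F : Type*} [NormedAddCommGroup V] [NormedSpace ℝ V]

/-- A finite family of compact convex sets with pairwise disjoint interiors: the abstract form of
the cells of a mesh. -/
structure IsCellFamily (s : Finset ι) (K : ι → Set V) : Prop where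
  isCompact : ∀ i ∈ s, IsCompact (K i)
  convex : ∀ i ∈ s, Convex ℝ (K i)
  disjoint : (s : Set ι).PairwiseDisjoint fun i => interior (K i)

/-- A function that agrees with a continuous function on the interior of every cell. The continuous
functions are defined everywhere, so that they are bounded on the closed cells. -/
def PiecewiseContinuous [TopologicalSpace F] (s : Finset ι) (K : ι → Set V) (g : V → F) : Prop :=
  ∀ i ∈ s, ∃ G : V → F, Continuous G ∧ EqOn g G (interior (K i))

variable {s : Finset ι} {K : ι → Set V}

namespace IsCellFamily

theorem isCompact_biUnion (h : IsCellFamily s K) : IsCompact (⋃ i ∈ s, K i) :=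
  s.isCompact_biUnion h.isCompact

theorem measure_interior_biUnion_ne_top [MeasurableSpace V] {ν : Measure V}
    [IsFiniteMeasureOnCompacts ν] (h : IsCellFamily s K) : ν (interior (⋃ i ∈ s, K i)) ≠ ∞ :=
  ((measure_mono interior_subset).trans_lt h.isCompact_biUnion.measure_lt_top).ne

variable [FiniteDimensional ℝ V] [MeasurableSpace V] [BorelSpace V] {ν : Measure V}
  [ν.IsAddHaarMeasure]

theorem interior_ae_eq (h : IsCellFamily s K) {i : ι} (hi : i ∈ s) :
    interior (K i) =ᵐ[ν] K i :=
  interior_ae_eq_of_null_frontier ((h.convex i hi).addHaar_frontier ν)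

theorem biUnion_interior_ae_eq (h : IsCellFamily s K) :
    (⋃ i ∈ s, interior (K i) : Set V) =ᵐ[ν] ⋃ i ∈ s, K i :=
  Filter.EventuallyEq.countable_bUnion s.countable_toSet fun _ hi => h.interior_ae_eq hi

theorem interior_biUnion_ae_eq (h : IsCellFamily s K) :
    (interior (⋃ i ∈ s, K i) : Set V) =ᵐ[ν] ⋃ i ∈ s, K i :=
  EventuallyLE.antisymm (LE.le.eventuallyLE interior_subset)
    (h.biUnion_interior_ae_eq.symm.le.trans
      (LE.le.eventuallyLE (iUnion₂_subset fun _ => interior_subset_interior_biUnion)))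

theorem interior_biUnion_ae_eq_biUnion_interior (h : IsCellFamily s K) :
    (interior (⋃ i ∈ s, K i) : Set V) =ᵐ[ν] ⋃ i ∈ s, interior (K i) :=
  h.interior_biUnion_ae_eq.trans h.biUnion_interior_ae_eq.symm

theorem ae_mem_interior (h : IsCellFamily s K) :
    ∀ᵐ x ∂(ν.restrict (interior (⋃ i ∈ s, K i))), ∃ i ∈ s, x ∈ interior (K i) := by
  rw [Measure.restrict_congr_set h.interior_biUnion_ae_eq_biUnion_interior]
  filter_upwards [ae_restrict_mem (Finset.measurableSet_biUnion s
    fun i _ => isOpen_interior.measurableSet)] with x hx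
  simpa using hx

theorem measure_frontier_interior_biUnion (h : IsCellFamily s K) :
    ν (frontier (interior (⋃ i ∈ s, K i))) = 0 := by
  refine measure_mono_null frontier_interior_subset ?_
  rw [h.isCompact_biUnion.isClosed.frontier_eq]
  exact ae_le_set.1 h.interior_biUnion_ae_eq.symm.le

theorem restrict_cell_le (h : IsCellFamily s K) {i : ι} (hi : i ∈ s) :
    ν.restrict (K i) ≤ ν.restrict (interior (⋃ i ∈ s, K i)) := by
  rw [← Measure.restrict_congr_set (h.interior_ae_eq hi)]
  exact Measure.restrict_mono (interior_subset_interior_biUnion hi) le_rfl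

theorem setIntegral_eq_sum [NormedAddCommGroup F] [NormedSpace ℝ F] (h : IsCellFamily s K)
    {g : V → F} (hg : IntegrableOn g (interior (⋃ i ∈ s, K i)) ν) :
    ∫ x in interior (⋃ i ∈ s, K i), g x ∂ν = ∑ i ∈ s, ∫ x in K i, g x ∂ν := by
  rw [setIntegral_congr_set h.interior_biUnion_ae_eq_biUnion_interior, integral_biUnion_finset s
    (fun i _ => isOpen_interior.measurableSet) h.disjoint
    (fun i hi => hg.mono_set (interior_subset_interior_biUnion hi))]
  exact Finset.sum_congr rfl fun i hi => setIntegral_congr_set (h.interior_ae_eq hi)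

end IsCellFamily

theorem PiecewiseContinuous.memLp [FiniteDimensional ℝ V] [MeasurableSpace V] [BorelSpace V]
    {ν : Measure V} [ν.IsAddHaarMeasure] [NormedAddCommGroup F] {g : V → F}
    (hg : PiecewiseContinuous s K g) (h : IsCellFamily s K) {p : ℝ≥0∞} :
    MemLp g p (ν.restrict (interior (⋃ i ∈ s, K i))) := by
  have := isFiniteMeasure_restrict.2 (h.measure_interior_biUnion_ne_top (ν := ν))
  choose! G hG hgG using hg
  have hbound : ∀ i ∈ s, ∃ C, ∀ x ∈ K i, ‖G i x‖ ≤ C := fun i hi =>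
    (h.isCompact i hi).exists_bound_of_continuousOn (hG i hi).continuousOn
  choose! C hC using hbound
  refine MemLp.of_bound ?_ (∑ i ∈ s, |C i|) ?_
  · rw [Measure.restrict_congr_set h.interior_biUnion_ae_eq_biUnion_interior,
      ← Finset.set_biUnion_coe, biUnion_eq_iUnion, aestronglyMeasurable_iUnion_iff]
    rintro ⟨i, hi⟩
    refine (hG i hi).aestronglyMeasurable.congr ?_
    filter_upwards [ae_restrict_mem isOpen_interior.measurableSet] with x hx
    exact (hgG i hi hx).symm
  · filter_upwards [h.ae_mem_interior] with x ⟨i, hi, hx⟩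
    rw [hgG i hi hx]
    exact ((hC i hi x (interior_subset hx)).trans (le_abs_self _)).trans
      (Finset.single_le_sum (f := fun i => |C i|) (fun j _ => abs_nonneg _) hi)

end Cells

/-! ### Lipschitz functions on finite covers -/

section Lipschitz

theorem lipschitzOnWith_congr {X Y : Type*} [PseudoEMetricSpace X] [PseudoEMetricSpace Y]
    {f g : X → Y} {s : Set X} {C : ℝ≥0} (hf : LipschitzOnWith C f s) (hgf : EqOn g f s) :
    LipschitzOnWith C g s := fun x hx y hy => by
  rw [hgf hx, hgf hy]
  exact hf hx hy

variable {V : Type*} [SeminormedAddCommGroup V] [NormedSpace ℝ V]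

theorem lipschitzWith_of_isClosed_cover {ι X : Type*} [Finite ι] [PseudoMetricSpace X]
    {K : ι → Set V} (hK : ∀ i, IsClosed (K i)) (hcover : ⋃ i, K i = univ) {f : V → X} {C : ℝ≥0}
    (hf : ∀ i, LipschitzOnWith C f (K i)) : LipschitzWith C f := by
  have hfc : Continuous f :=
    (locallyFinite_of_finite K).continuous hcover hK fun i => (hf i).continuousOn
  refine LipschitzWith.of_dist_le_mul fun y x => ?_
  let γ : ℝ → V := AffineMap.lineMap x y
  have hγ : Continuous γ := AffineMap.lineMap_continuous
  have hγx : γ 0 = x := AffineMap.lineMap_apply_zero x y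
  have hγy : γ 1 = y := AffineMap.lineMap_apply_one x y
  -- Just to the right of `t`, the segment meets some `K i` frequently; this `K i` contains `γ t`.
  have hslope : ∀ t r, C * dist y x < r →
      ∃ᶠ z in 𝓝[>] t, slope (fun z => dist (f (γ z)) (f x)) t z < r := by
    intro t r hr
    obtain ⟨i, hi⟩ : ∃ i, ∃ᶠ z in 𝓝[>] t, γ z ∈ K i := by
      by_contra! hnot
      obtain ⟨z, hz⟩ := (eventually_all.2 hnot).exists
      exact absurd (hcover.symm ▸ mem_univ (γ z)) (by simpa using hz)
    have hti : γ t ∈ K i := (hK i).mem_of_frequently_of_tendsto hi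
      ((hγ.tendsto t).mono_left nhdsWithin_le_nhds)
    refine (hi.and_eventually self_mem_nhdsWithin).mono fun z ⟨hz, (htz : t < z)⟩ => ?_
    rw [slope_def_field]
    refine lt_of_le_of_lt ((div_le_iff₀ (sub_pos.2 htz)).2 ?_) hr
    calc dist (f (γ z)) (f x) - dist (f (γ t)) (f x)
        ≤ dist (f (γ z)) (f (γ t)) := by linarith [dist_triangle (f (γ z)) (f (γ t)) (f x)]
      _ ≤ C * dist (γ z) (γ t) := (hf i).dist_le_mul _ hz _ hti
      _ = C * dist y x * (z - t) := by
        rw [dist_lineMap_lineMap, Real.dist_eq, abs_of_pos (sub_pos.2 htz), dist_comm x y]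
        ring
  have hbound := image_le_of_liminf_slope_right_le_deriv_boundary
    (B := fun t => t * (C * dist y x)) (hfc.comp hγ |>.dist continuous_const).continuousOn
    (by simp [hγx]) (by fun_prop)
    (fun t _ => ((hasDerivAt_id t).mul_const (C * dist y x)).hasDerivWithinAt)
    (fun t _ r hr => hslope t r (by simpa using hr)) (right_mem_Icc.2 zero_le_one)
  simpa [hγy] using hbound

theorem exists_lipschitzWith_indicator {ι F : Type*} [SeminormedAddCommGroup F] {s : Finset ι}
    {K : ι → Set V} (hK : ∀ i ∈ s, IsClosed (K i)) {f : V → F}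
    (hf₀ : ∀ x ∈ frontier (⋃ i ∈ s, K i), f x = 0)
    (hf : ∀ i ∈ s, ∃ C : ℝ≥0, LipschitzOnWith C f (K i)) :
    ∃ C : ℝ≥0, LipschitzWith C ((⋃ i ∈ s, K i).indicator f) := by
  choose! C hC using hf
  set D := ⋃ i ∈ s, K i
  let L : Option s → Set V := fun o => o.elim (closure Dᶜ) fun i => K i
  refine ⟨s.sup C, lipschitzWith_of_isClosed_cover (K := L) ?_ ?_ ?_⟩
  · rintro (_ | ⟨i, hi⟩)
    exacts [isClosed_closure, hK i hi]
  · refine eq_univ_of_forall fun x => mem_iUnion.2 ?_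
    by_cases hx : x ∈ D
    · obtain ⟨i, hi, hxi⟩ := mem_iUnion₂.1 hx
      exact ⟨some ⟨i, hi⟩, hxi⟩
    · exact ⟨none, subset_closure hx⟩
  · have hzero : ∀ x ∈ closure Dᶜ, D.indicator f x = 0 := fun x hx => by
      by_cases hxD : x ∈ D
      · rw [indicator_of_mem hxD]
        refine hf₀ x ?_
        rw [frontier_eq_closure_inter_closure]
        exact ⟨subset_closure hxD, hx⟩
      · exact indicator_of_notMem hxD f
    rintro (_ | ⟨i, hi⟩) x hx y hy
    · simp [hzero x hx, hzero y hy]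
    · have hKD : K i ⊆ D := subset_biUnion_of_mem (u := K) hi
      rw [indicator_of_mem (hKD hx), indicator_of_mem (hKD hy)]
      exact (hC i hi).weaken (Finset.le_sup hi) hx hy

theorem exists_lipschitzOnWith_smul {α F : Type*} [PseudoMetricSpace α] [SeminormedAddCommGroup F]
    [NormedSpace ℝ F] {s : Set α} (hs : IsCompact s) {f : α → ℝ} {g : α → F}
    (hf : ∃ C : ℝ≥0, LipschitzOnWith C f s) (hg : ∃ C : ℝ≥0, LipschitzOnWith C g s) :
    ∃ C : ℝ≥0, LipschitzOnWith C (fun x => f x • g x) s := by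
  obtain ⟨A, hA⟩ := hf
  obtain ⟨B, hB⟩ := hg
  obtain ⟨M, hM⟩ := hs.exists_bound_of_continuousOn hA.continuousOn
  obtain ⟨N, hN⟩ := hs.exists_bound_of_continuousOn hB.continuousOn
  refine ⟨M.toNNReal * B + A * N.toNNReal, LipschitzOnWith.of_dist_le_mul fun x hx y hy => ?_⟩
  have hM' : ‖f x‖ ≤ M.toNNReal := (hM x hx).trans M.le_coe_toNNReal
  have hN' : ‖g y‖ ≤ N.toNNReal := (hN y hy).trans N.le_coe_toNNReal
  calc dist (f x • g x) (f y • g y)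
      ≤ dist (f x • g x) (f x • g y) + dist (f x • g y) (f y • g y) := dist_triangle _ _ _
    _ ≤ ‖f x‖ * dist (g x) (g y) + dist (f x) (f y) * ‖g y‖ := by
      simp only [dist_eq_norm, ← smul_sub, ← sub_smul, norm_smul, le_refl]
    _ ≤ M.toNNReal * (B * dist x y) + A * dist x y * N.toNNReal := by
      gcongr
      exacts [hB.dist_le_mul x hx y hy, hA.dist_le_mul x hx y hy]
    _ = ↑(M.toNNReal * B + A * N.toNNReal) * dist x y := by push_cast; ring

end Lipschitz

/-! ### The divergence and integration by parts -/

section Divergence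

variable {d : ℕ} {F G : E d → E d} {x : E d}

theorem divergence_congr (h : F =ᶠ[𝓝 x] G) : divergence F x = divergence G x := by
  rw [divergence, divergence, h.fderiv_eq]

theorem divergence_sub (hF : DifferentiableAt ℝ F x) (hG : DifferentiableAt ℝ G x) :
    divergence (fun y => F y - G y) x = divergence F x - divergence G x := by
  simp only [divergence, fderiv_fun_sub hF hG, sub_apply, PiLp.sub_apply, Finset.sum_sub_distrib]

theorem inner_gradient_eq_sum (v : E d → ℝ) (x z : E d) :
    inner ℝ z (gradient v x) = ∑ j, z j * fderiv ℝ v x (EuclideanSpace.single j 1) := by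
  rw [real_inner_comm, gradient, InnerProductSpace.toDual_symm_apply]
  conv_lhs => rw [← (EuclideanSpace.basisFun (Fin d) ℝ).sum_repr z]
  simp

theorem divergence_smul {g : E d → ℝ} (hg : DifferentiableAt ℝ g x)
    (hF : DifferentiableAt ℝ F x) :
    divergence (fun y => g y • F y) x = inner ℝ (F x) (gradient g x) + g x * divergence F x := by
  simp only [divergence, fderiv_fun_smul hg hF, inner_gradient_eq_sum, Finset.mul_sum,
    ← Finset.sum_add_distrib]
  refine Finset.sum_congr rfl fun j _ => ?_
  simp
  ring

theorem divergence_sq_smul {v : E d → ℝ} (hv : DifferentiableAt ℝ v x)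
    (hF : DifferentiableAt ℝ F x) :
    divergence (fun y => v y ^ 2 • F y) x =
      2 * (inner ℝ (F x) (gradient v x) * v x) + divergence F x * v x ^ 2 := by
  have hgrad : gradient (fun y => v y ^ 2) x = (2 * v x) • gradient v x := by
    have := hv.hasGradientAt.hasFDerivAt.pow 2
    exact HasGradientAt.gradient (this.congr_fderiv (by simp))
  rw [divergence_smul (g := fun y => v y ^ 2) (hv.pow 2) hF, hgrad, real_inner_smul_right]
  ring

theorem norm_divergence_le (F : E d → E d) (x : E d) :
    ‖divergence F x‖ ≤ d * ‖fderiv ℝ F x‖ :=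
  calc ‖divergence F x‖ ≤ ∑ _j : Fin d, ‖fderiv ℝ F x‖ := by
        refine norm_sum_le_of_le _ fun j _ => (PiLp.norm_apply_le _ j).trans ?_
        simpa using (fderiv ℝ F x).le_opNorm (EuclideanSpace.single j 1)
    _ = d * ‖fderiv ℝ F x‖ := by simp

theorem measurable_divergence (F : E d → E d) : Measurable (divergence F) :=
  Finset.measurable_fun_sum _ fun j _ => (EuclideanSpace.proj (𝕜 := ℝ) j).continuous.measurable.comp
    (measurable_fderiv_apply_const ℝ F _)

theorem memLp_top_divergence {C : ℝ≥0} {U : Set (E d)} (hU : IsOpen U)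
    (hF : LipschitzOnWith C F U) {ν : Measure (E d)} :
    MemLp (divergence F) ∞ (ν.restrict U) := by
  refine memLp_top_of_bound (measurable_divergence F).aestronglyMeasurable (d * C) ?_
  filter_upwards [ae_restrict_mem hU.measurableSet] with x hx
  exact (norm_divergence_le F x).trans (by
    gcongr; exact norm_fderiv_le_of_lipschitzOn ℝ (hU.mem_nhds hx) hF)

theorem ae_differentiableAt_of_lipschitzOnWith {V W : Type*} [NormedAddCommGroup V]
    [NormedSpace ℝ V] [FiniteDimensional ℝ V] [NormedAddCommGroup W] [NormedSpace ℝ W]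
    [FiniteDimensional ℝ W] [MeasurableSpace V] [BorelSpace V] {ν : Measure V}
    [ν.IsAddHaarMeasure] {f : V → W} {C : ℝ≥0} {U : Set V} (hU : IsOpen U)
    (hf : LipschitzOnWith C f U) : ∀ᵐ x ∂(ν.restrict U), DifferentiableAt ℝ f x := by
  filter_upwards [hf.ae_differentiableWithinAt (μ := ν) hU.measurableSet,
    ae_restrict_mem hU.measurableSet] with x hx hxU
  exact hx.differentiableAt (hU.mem_nhds hxU)

theorem integral_lineDeriv_eq_zero {V : Type*} [NormedAddCommGroup V] [NormedSpace ℝ V]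
    [FiniteDimensional ℝ V] [MeasurableSpace V] [BorelSpace V] {ν : Measure V}
    [ν.IsAddHaarMeasure] {g : V → ℝ} {C : ℝ≥0} (hg : LipschitzWith C g)
    (hs : HasCompactSupport g) (v : V) : ∫ x, lineDeriv ℝ g x v ∂ν = 0 := by
  have := LipschitzWith.integral_lineDeriv_mul_eq (μ := ν)
    (LipschitzWith.const (1 : ℝ) : LipschitzWith 0 fun _ : V => (1 : ℝ)) hg hs (-v)
  simpa [lineDeriv] using this.symm

theorem integral_divergence_eq_zero {C : ℝ≥0} (hF : LipschitzWith C F)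
    (hs : HasCompactSupport F) : ∫ x, divergence F x = 0 := by
  have hFj : ∀ j, LipschitzWith C fun x => F x j := fun j =>
    LipschitzWith.of_dist_le_mul fun x y => by
      simpa [dist_eq_norm] using (PiLp.norm_apply_le (F x - F y) j).trans (hF.norm_sub_le x y)
  have hsj : ∀ j, HasCompactSupport fun x => F x j := fun j =>
    hs.comp_left (g := fun z : E d => z j) rfl
  have hdiv : divergence F =ᵐ[volume] fun x =>
      ∑ j, lineDeriv ℝ (fun y => F y j) x (EuclideanSpace.single j 1) := by
    filter_upwards [hF.ae_differentiableAt (μ := volume)] with x hx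
    refine Finset.sum_congr rfl fun j _ => Eq.symm ?_
    exact ((EuclideanSpace.proj (𝕜 := ℝ) j).hasFDerivAt.comp x hx.hasFDerivAt).hasLineDerivAt
      _ |>.lineDeriv
  rw [integral_congr_ae hdiv, integral_finsetSum _ fun j _ => ?_]
  · exact Finset.sum_eq_zero fun j _ => integral_lineDeriv_eq_zero (hFj j) (hsj j) _
  · have hLI := (hFj j).locallyIntegrable_lineDeriv (μ := volume) (EuclideanSpace.single j 1)
    refine (integrableOn_iff_integrable_of_support_subset fun x hx => ?_).1
      (hLI.integrableOn_isCompact (hsj j))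
    contrapose! hx
    have hzero := (notMem_tsupport_iff_eventuallyEq.1 hx).lineDeriv_eq (𝕜 := ℝ)
      (v := EuclideanSpace.single j 1)
    exact Function.notMem_support.2 (hzero.trans (by simp [lineDeriv]))

theorem setIntegral_divergence_eq_zero {U : Set (E d)} (hU : IsOpen U)
    (hUb : Bornology.IsBounded U) (hUf : volume (frontier U) = 0) {C : ℝ≥0}
    (hF : LipschitzWith C (U.indicator F)) : ∫ x in U, divergence F x = 0 := by
  have hs : HasCompactSupport (U.indicator F) :=
    HasCompactSupport.intro' hUb.isCompact_closure isClosed_closure fun x hx =>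
      indicator_of_notMem (fun hxU => hx (subset_closure hxU)) F
  calc ∫ x in U, divergence F x = ∫ x in U, divergence (U.indicator F) x :=
        setIntegral_congr_fun hU.measurableSet fun x hx =>
          divergence_congr (eqOn_indicator.eventuallyEq_of_mem (hU.mem_nhds hx)).symm
    _ = ∫ x, divergence (U.indicator F) x := by
      refine setIntegral_eq_integral_of_ae_compl_eq_zero ?_
      filter_upwards [measure_eq_zero_iff_ae_notMem.1 hUf] with x hxf hxU
      have hx : x ∈ (closure U)ᶜ := fun hxc => hxf ⟨hxc, by rwa [hU.interior_eq]⟩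
      have hzero : U.indicator F =ᶠ[𝓝 x] fun _ => 0 := by
        filter_upwards [isClosed_closure.isOpen_compl.mem_nhds hx] with y hy
        exact indicator_of_notMem (fun hyU => hy (subset_closure hyU)) F
      rw [divergence_congr hzero]
      simp [divergence]
    _ = 0 := integral_divergence_eq_zero hF hs

end Divergence

/-! ### Determinants along a segment of linear maps -/

section Determinant

variable {V : Type*} [AddCommGroup V] [Module ℝ V] [FiniteDimensional ℝ V] {a b : Module.End ℝ V}

theorem contDiff_det_lineMap (a b : Module.End ℝ V) :
    ContDiff ℝ 1 fun s : ℝ => LinearMap.det (AffineMap.lineMap a b s) := by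
  let e := Module.finBasis ℝ V
  simp only [← LinearMap.det_toMatrix e, AffineMap.lineMap_apply_module, map_add, map_smul,
    Matrix.det_apply]
  refine ContDiff.sum fun σ _ => ContDiff.const_smul _ (contDiff_prod fun i _ => ?_)
  simp only [Matrix.add_apply, Matrix.smul_apply, smul_eq_mul]
  fun_prop

theorem hasDerivAt_det_one_add_smul (f : Module.End ℝ V) :
    HasDerivAt (fun r : ℝ => LinearMap.det (1 + r • f)) (LinearMap.trace ℝ V f) 0 := by
  let e := Module.finBasis ℝ V
  let P : Polynomial ℝ :=
    (1 + (Polynomial.X : Polynomial ℝ) • (LinearMap.toMatrix e e f).map Polynomial.C).det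
  have hP : ∀ r, P.eval r = LinearMap.det (1 + r • f) := fun r => by
    rw [← LinearMap.det_toMatrix e, ← Polynomial.coe_evalRingHom, RingHom.map_det]
    congr 1
    ext i j
    simp [Matrix.one_apply, apply_ite, LinearMap.toMatrix_one, mul_comm r]
  simp only [← hP]
  refine (P.hasDerivAt 0).congr_deriv ?_
  rw [Matrix.derivative_det_one_add_X_smul, LinearMap.trace_eq_matrix_trace ℝ e]

theorem hasDerivAt_det_lineMap {s : ℝ} {q : Module.End ℝ V}
    (hq : AffineMap.lineMap a b s * q = 1) :
    HasDerivAt (fun r : ℝ => LinearMap.det (AffineMap.lineMap a b r))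
      (LinearMap.det (AffineMap.lineMap a b s) * LinearMap.trace ℝ V ((b - a) * q)) s := by
  have hfactor : ∀ r : ℝ, LinearMap.det (AffineMap.lineMap a b r) =
      LinearMap.det (AffineMap.lineMap a b s) * LinearMap.det (1 + (r - s) • ((b - a) * q)) := by
    intro r
    rw [mul_comm, ← map_mul]
    congr 1
    rw [add_mul, one_mul, smul_mul_assoc, mul_assoc, mul_eq_one_comm.1 hq, mul_one,
      AffineMap.lineMap_apply_module, AffineMap.lineMap_apply_module]
    module
  have hone : HasDerivAt (fun r : ℝ => LinearMap.det (1 + r • ((b - a) * q)))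
      (LinearMap.trace ℝ V ((b - a) * q)) (s - s) :=
    sub_self s ▸ hasDerivAt_det_one_add_smul _
  rw [funext hfactor]
  exact (hone.comp_sub_const s s).const_mul _

variable (h : ∀ s ∈ Icc (0 : ℝ) 1, LinearMap.det (AffineMap.lineMap a b s) ≠ 0)

include h

theorem det_div_det_pos : 0 < LinearMap.det b / LinearMap.det a := by
  have ha : LinearMap.det a ≠ 0 := by simpa using h 0 (by simp)
  let ρ : ℝ → ℝ := fun s => LinearMap.det (AffineMap.lineMap a b s) / LinearMap.det a
  have hρ : ContinuousOn ρ (Icc 0 1) :=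
    ((contDiff_det_lineMap a b).continuous.div_const _).continuousOn
  have hρ₀ : ρ 0 = 1 := by simp [ρ, ha]
  have hρ₁ : ρ 1 = LinearMap.det b / LinearMap.det a := by simp [ρ]
  by_contra! hneg
  obtain ⟨s, hs, hs₀⟩ := intermediate_value_Icc' zero_le_one hρ
    (show (0 : ℝ) ∈ Icc (ρ 1) (ρ 0) from ⟨hρ₁ ▸ hneg, hρ₀ ▸ zero_le_one⟩)
  exact div_ne_zero (h s hs) ha hs₀

theorem exists_abs_trace_le :
    ∃ C, ∀ s ∈ Icc (0 : ℝ) 1, ∀ q, AffineMap.lineMap a b s * q = 1 →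
      |LinearMap.trace ℝ V ((b - a) * q)| ≤ C := by
  obtain ⟨C, hC⟩ := isCompact_Icc.exists_bound_of_continuousOn
    (((contDiff_det_lineMap a b).continuous_deriv le_rfl).continuousOn.div
      (contDiff_det_lineMap a b).continuous.continuousOn h)
  refine ⟨C, fun s hs q hq => ?_⟩
  simpa [(hasDerivAt_det_lineMap hq).deriv, mul_div_cancel_left₀ _ (h s hs)] using hC s hs

/-- The mean value theorem for `log det` and `J - 1 ≤ J log J`. -/
theorem exists_det_div_det_sub_one_le :
    ∃ s ∈ Ioo (0 : ℝ) 1, ∀ q, AffineMap.lineMap a b s * q = 1 →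
      LinearMap.det b / LinearMap.det a - 1 ≤
        |LinearMap.det b / LinearMap.det a * LinearMap.trace ℝ V ((b - a) * q)| := by
  let D : ℝ → ℝ := fun s => LinearMap.det (AffineMap.lineMap a b s)
  have hD : ContDiff ℝ 1 D := contDiff_det_lineMap a b
  obtain ⟨s, hs, hslope⟩ := exists_hasDerivAt_eq_slope (fun s => Real.log (D s))
    (fun s => deriv D s / D s) zero_lt_one (hD.continuous.continuousOn.log h) fun s hs =>
      ((hD.differentiable one_ne_zero s).hasDerivAt).log (h s (Ioo_subset_Icc_self hs))
  refine ⟨s, hs, fun q hq => ?_⟩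
  set J := LinearMap.det b / LinearMap.det a with hJ
  have hJpos : 0 < J := det_div_det_pos h
  have htrace : LinearMap.trace ℝ V ((b - a) * q) = Real.log J := by
    rw [(hasDerivAt_det_lineMap hq).deriv,
      mul_div_cancel_left₀ _ (h s (Ioo_subset_Icc_self hs)), sub_zero, div_one,
      ← Real.log_div (h 1 (by simp)) (h 0 (by simp))] at hslope
    simpa only [D, AffineMap.lineMap_apply_zero, AffineMap.lineMap_apply_one] using hslope
  calc J - 1 = J * (1 - J⁻¹) := by field_simp
    _ ≤ J * Real.log J := by gcongr; exact Real.one_sub_inv_le_log_of_pos hJpos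
    _ ≤ |J * LinearMap.trace ℝ V ((b - a) * q)| := htrace ▸ le_abs_self _

end Determinant

/-! ### Affine maps -/

section Affine

theorem linear_mul_symm_linear {K V : Type*} [Ring K] [AddCommGroup V] [Module K V]
    (g : V ≃ᵃ[K] V) :
    ((g : V →ᵃ[K] V).linear * (g.symm : V →ᵃ[K] V).linear : Module.End K V) = 1 := by
  ext v
  simp

variable {V W : Type*} [NormedAddCommGroup V] [NormedSpace ℝ V] [FiniteDimensional ℝ V]
  [NormedAddCommGroup W] [NormedSpace ℝ W]

theorem hasFDerivAt_affineMap (g : V →ᵃ[ℝ] W) (x : V) :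
    HasFDerivAt g (LinearMap.toContinuousLinearMap g.linear) x := by
  rw [g.decomp]
  exact (LinearMap.toContinuousLinearMap g.linear).hasFDerivAt.add_const _

theorem exists_lipschitzWith_affineMap (g : V →ᵃ[ℝ] W) : ∃ C : ℝ≥0, LipschitzWith C g :=
  ⟨_, lipschitzWith_of_nnnorm_fderiv_le (fun x => (hasFDerivAt_affineMap g x).differentiableAt)
    fun x => by rw [(hasFDerivAt_affineMap g x).fderiv]⟩

theorem bijective_affineMap_of_injOn {g : V →ᵃ[ℝ] V} {s : Set V} (hs : (interior s).Nonempty)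
    (hg : InjOn g s) : Function.Bijective g := by
  obtain ⟨x, hx⟩ := hs
  have hker : ∀ v, g.linear v = 0 → v = 0 := fun v hv => by
    have hline : Tendsto (fun r : ℝ => r • v + x) (𝓝[≠] 0) (𝓝 x) :=
      (Continuous.tendsto' (by fun_prop) 0 x (by simp)).mono_left nhdsWithin_le_nhds
    obtain ⟨r, hr, hr₀⟩ := ((hline.eventually (mem_interior_iff_mem_nhds.1 hx)).and
      self_mem_nhdsWithin).exists
    have heq : g (r • v + x) = g x := by simpa [hv] using g.map_vadd x (r • v)
    simpa [show r ≠ 0 from hr₀] using hg hr (interior_subset hx) heq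
  have hinj : Function.Injective g.linear := (injective_iff_map_eq_zero g.linear).2 hker
  exact g.linear_bijective_iff.1 ⟨hinj, LinearMap.injective_iff_surjective.1 hinj⟩

theorem divergence_affineMap {d : ℕ} (g : E d →ᵃ[ℝ] E d) (x : E d) :
    divergence g x = LinearMap.trace ℝ (E d) g.linear := by
  rw [divergence, (hasFDerivAt_affineMap g x).fderiv,
    LinearMap.trace_eq_sum_inner _ (EuclideanSpace.basisFun (Fin d) ℝ)]
  simp [EuclideanSpace.inner_single_left]

end Affine

/-! ### Triangulations -/

theorem image_interior_affineEquiv {V : Type*} [NormedAddCommGroup V] [NormedSpace ℝ V]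
    [FiniteDimensional ℝ V] (g : V ≃ᵃ[ℝ] V) (s : Set V) :
    g '' interior s = interior (g '' s) :=
  (AffineEquiv.toContinuousAffineEquiv g).toHomeomorph.image_interior s

theorem det_linear_comp_symm {K V : Type*} [Field K] [AddCommGroup V] [Module K V]
    (g h : V ≃ᵃ[K] V) :
    LinearMap.det ((h : V →ᵃ[K] V).comp (g.symm : V →ᵃ[K] V)).linear =
      LinearMap.det (h : V →ᵃ[K] V).linear / LinearMap.det (g : V →ᵃ[K] V).linear := by
  have hdet := congrArg LinearMap.det (linear_mul_symm_linear g)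
  rw [map_mul, map_one] at hdet
  rw [AffineMap.comp_linear, LinearMap.det_comp, div_eq_mul_inv,
    eq_inv_of_mul_eq_one_right hdet]

namespace Triangulation

variable {d : ℕ} {M : Triangulation d} {σ τ : Finset (E d)} {φ : E d → E d}

theorem mem_cells : σ ∈ M.cells ↔ σ ∈ M.faces ∧ σ.card = d + 1 := by
  simp [cells]

theorem region_eq : M.region = ⋃ σ ∈ M.cells, convexHull ℝ (σ : Set (E d)) := by
  ext x
  simp only [Geometry.SimplicialComplex.mem_space_iff, mem_iUnion, exists_prop]
  constructor
  · rintro ⟨s, hs, hx⟩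
    obtain ⟨σ, hσ, hsσ, hcard⟩ := M.pure_faces s hs
    exact ⟨σ, mem_cells.2 ⟨hσ, hcard⟩, convexHull_mono (Finset.coe_subset.2 hsσ) hx⟩
  · rintro ⟨σ, hσ, hx⟩
    exact ⟨σ, (mem_cells.1 hσ).1, hx⟩

theorem image_region : φ '' M.region = ⋃ σ ∈ M.cells, φ '' convexHull ℝ (σ : Set (E d)) := by
  rw [region_eq, image_iUnion₂]

theorem hull_subset_region (hσ : σ ∈ M.cells) : convexHull ℝ (σ : Set (E d)) ⊆ M.region :=
  Geometry.SimplicialComplex.convexHull_subset_space (mem_cells.1 hσ).1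

theorem interior_hull_nonempty (hσ : σ ∈ M.cells) :
    (interior (convexHull ℝ (σ : Set (E d)))).Nonempty := by
  obtain ⟨hface, hcard⟩ := mem_cells.1 hσ
  have := (M.indep hface).affineSpan_eq_top_iff_card_eq_finrank_add_one.2 (by simp [hcard])
  rw [interior_convexHull_nonempty_iff_affineSpan_eq_top]
  simpa using this

theorem interior_hull_inter_eq_empty (hσ : σ ∈ M.cells) (hτ : τ ∈ M.cells) (hne : σ ≠ τ) :
    interior (convexHull ℝ (σ : Set (E d)) ∩ convexHull ℝ (τ : Set (E d))) = ∅ := by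
  obtain ⟨hσf, hσc⟩ := mem_cells.1 hσ
  obtain ⟨hτf, hτc⟩ := mem_cells.1 hτ
  by_contra hint
  have hspan := (nonempty_iff_ne_empty.2 hint).mono
    (interior_mono (M.inter_subset_convexHull hσf hτf))
  rw [interior_convexHull_nonempty_iff_affineSpan_eq_top, ← Finset.coe_inter] at hspan
  have hindep : AffineIndependent ℝ ((↑) : (σ ∩ τ : Finset (E d)) → E d) :=
    (M.indep hσf).mono (Finset.coe_subset.2 Finset.inter_subset_left)
  have hcard : (σ ∩ τ).card = d + 1 := by
    simpa using hindep.affineSpan_eq_top_iff_card_eq_finrank_add_one.1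
      (by rwa [Subtype.range_coe_subtype, Finset.setOfPred_mem])
  have hστ := Finset.eq_of_subset_of_card_le (Finset.inter_subset_left (s₁ := σ) (s₂ := τ))
    (by rw [hcard, hσc])
  exact hne (Finset.eq_of_subset_of_card_le (Finset.inter_eq_left.1 hστ) (by rw [hσc, hτc]))

namespace IsP1Map

theorem exists_affineEquiv (h : M.IsP1Map φ) (hφ : InjOn φ M.region) (hσ : σ ∈ M.cells) :
    ∃ g : E d ≃ᵃ[ℝ] E d, EqOn φ g (convexHull ℝ (σ : Set (E d))) := by
  obtain ⟨g, hg⟩ := h.2 σ hσ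
  exact ⟨AffineEquiv.ofBijective (bijective_affineMap_of_injOn (interior_hull_nonempty hσ)
    ((hφ.mono (hull_subset_region hσ)).congr hg)), hg⟩

theorem isCellFamily (h : M.IsP1Map φ) (hφ : InjOn φ M.region) :
    IsCellFamily M.cells fun σ => φ '' convexHull ℝ (σ : Set (E d)) where
  isCompact σ hσ := (σ.finite_toSet.isCompact_convexHull ℝ).image_of_continuousOn
    (h.1.mono (hull_subset_region hσ))
  convex σ hσ := by
    obtain ⟨g, hg⟩ := h.2 σ hσ
    rw [hg.image_eq]
    exact (convex_convexHull ℝ _).affine_image g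
  disjoint σ hσ τ hτ hne := by
    obtain ⟨g, hg⟩ := h.exists_affineEquiv hφ hσ
    rw [Function.onFun, disjoint_iff_inter_eq_empty, ← interior_inter,
      ← hφ.image_inter (hull_subset_region hσ) (hull_subset_region hτ),
      (hg.mono inter_subset_left).image_eq, ← image_interior_affineEquiv,
      interior_hull_inter_eq_empty hσ hτ hne, image_empty]

end IsP1Map

end Triangulation

/-! ### Admissible schemes -/

namespace Scheme

variable {d : ℕ} {S : Scheme d} {m n : ℕ} {t : ℝ} {σ : Finset (E d)}

/-- The standing assumptions on the time levels and the ALE mappings. -/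
structure Admissible (S : Scheme d) : Prop where
  dt_pos : 0 < S.dt
  isP1Map : ∀ n ≤ S.N, S.mesh.IsP1Map (S.A (S.time n))
  injOn_interp : ∀ n < S.N, ∀ t ∈ Icc (S.time n) (S.time (n + 1)),
    InjOn (S.interp n t) S.mesh.region

/-- The position `(t - t^n) / Δt` of a time `t` within the step from `t^n` to `t^{n+1}`. -/
noncomputable def fraction (S : Scheme d) (n : ℕ) (t : ℝ) : ℝ := (t - S.time n) / S.dt

theorem time_succ (S : Scheme d) (n : ℕ) : S.time (n + 1) = S.time n + S.dt := by
  simp [time, add_mul]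

theorem closedDom_eq (S : Scheme d) (n : ℕ) : S.closedDom n = ⋃ σ ∈ S.mesh.cells, S.cell n σ :=
  Triangulation.image_region

theorem dom_eq (S : Scheme d) (n : ℕ) :
    S.dom n = interior (⋃ σ ∈ S.mesh.cells, S.cell n σ) := by
  rw [dom, closedDom_eq]

namespace Admissible

theorem time_le_time_succ (h : S.Admissible) (n : ℕ) : S.time n ≤ S.time (n + 1) := by
  rw [time_succ]
  exact le_add_of_nonneg_right h.dt_pos.le

theorem fraction_add_mul (h : S.Admissible) (n : ℕ) (s : ℝ) :
    S.fraction n (S.time n + s * S.dt) = s := by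
  rw [fraction, add_sub_cancel_left, mul_div_cancel_right₀ _ h.dt_pos.ne']

theorem fraction_mem_Icc (h : S.Admissible) (ht : t ∈ Icc (S.time n) (S.time (n + 1))) :
    S.fraction n t ∈ Icc 0 1 := by
  rw [time_succ] at ht
  exact ⟨div_nonneg (sub_nonneg.2 ht.1) h.dt_pos.le,
    (div_le_one h.dt_pos).2 (sub_le_iff_le_add'.2 ht.2)⟩

theorem interp_eq_lineMap (h : S.Admissible) (n : ℕ) (t : ℝ) (Y : E d) :
    S.interp n t Y =
      AffineMap.lineMap (S.A (S.time n) Y) (S.A (S.time (n + 1)) Y) (S.fraction n t) := by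
  have hfrac : (S.time (n + 1) - t) / S.dt = 1 - S.fraction n t := by
    rw [fraction, time_succ, eq_sub_iff_add_eq, ← add_div, div_eq_one_iff_eq h.dt_pos.ne']
    ring
  rw [interp, hfrac, AffineMap.lineMap_apply_module, add_comm, fraction]

theorem interp_left (h : S.Admissible) (n : ℕ) : S.interp n (S.time n) = S.A (S.time n) := by
  funext Y
  simp [h.interp_eq_lineMap, fraction]

theorem interp_right (h : S.Admissible) (n : ℕ) :
    S.interp n (S.time (n + 1)) = S.A (S.time (n + 1)) := by
  funext Y
  simp [h.interp_eq_lineMap, fraction, time_succ, h.dt_pos.ne']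

theorem injOn (h : S.Admissible) (hn : n ≤ S.N) : InjOn (S.A (S.time n)) S.mesh.region := by
  rcases hn.lt_or_eq with hlt | rfl
  · rw [← h.interp_left]
    exact h.injOn_interp n hlt _ (left_mem_Icc.2 (h.time_le_time_succ n))
  · have hN : S.N ≠ 0 := fun hN => h.dt_pos.ne' (by simp [dt, hN])
    obtain ⟨k, hk⟩ := Nat.exists_eq_succ_of_ne_zero hN
    rw [hk, Nat.succ_eq_add_one, ← h.interp_right]
    exact h.injOn_interp k (by omega) _ (right_mem_Icc.2 (h.time_le_time_succ k))

theorem isP1Map_interp (h : S.Admissible) (hn : n < S.N) (t : ℝ) :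
    S.mesh.IsP1Map (S.interp n t) := by
  obtain ⟨hcont₀, haff₀⟩ := h.isP1Map n hn.le
  obtain ⟨hcont₁, haff₁⟩ := h.isP1Map (n + 1) hn
  refine ⟨by unfold interp; fun_prop, fun σ hσ => ?_⟩
  obtain ⟨g₀, hg₀⟩ := haff₀ σ hσ
  obtain ⟨g₁, hg₁⟩ := haff₁ σ hσ
  refine ⟨AffineMap.lineMap g₀ g₁ (S.fraction n t), fun Y hY => ?_⟩
  rw [h.interp_eq_lineMap, hg₀ hY, hg₁ hY]
  simp [AffineMap.lineMap_apply]

theorem isCellFamily (h : S.Admissible) (hn : n ≤ S.N) :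
    IsCellFamily S.mesh.cells (S.cell n) :=
  (h.isP1Map n hn).isCellFamily (h.injOn hn)

theorem transfer_eqOn (h : S.Admissible) (hm : m ≤ S.N) (hσ : σ ∈ S.mesh.cells)
    {g g' : E d ≃ᵃ[ℝ] E d} (hg : EqOn (S.A (S.time m)) g (convexHull ℝ (σ : Set (E d))))
    (hg' : EqOn (S.A (S.time n)) g' (convexHull ℝ (σ : Set (E d)))) :
    EqOn (S.transfer m n) ((g' : E d →ᵃ[ℝ] E d).comp (g.symm : E d →ᵃ[ℝ] E d))
      (S.cell m σ) := by
  rintro _ ⟨Y, hY, rfl⟩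
  rw [transfer, (h.injOn hm).leftInvOn_invFunOn (Triangulation.hull_subset_region hσ hY), hg hY,
    hg' hY]
  simp

end Admissible

/-! ### The Jacobian of a time step -/

/-- The affine isomorphisms that the ALE mappings at the two ends of the step from `t^n` to
`t^{n+1}` induce on a reference cell. -/
structure StepMaps (S : Scheme d) (n : ℕ) (σ : Finset (E d)) where
  left : E d ≃ᵃ[ℝ] E d
  right : E d ≃ᵃ[ℝ] E d
  eqOn_left : EqOn (S.A (S.time n)) left (convexHull ℝ (σ : Set (E d)))
  eqOn_right : EqOn (S.A (S.time (n + 1))) right (convexHull ℝ (σ : Set (E d)))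

theorem Admissible.nonempty_stepMaps (h : S.Admissible) (hn : n < S.N)
    (hσ : σ ∈ S.mesh.cells) : Nonempty (S.StepMaps n σ) := by
  obtain ⟨g, hg⟩ := (h.isP1Map n hn.le).exists_affineEquiv (h.injOn hn.le) hσ
  obtain ⟨g', hg'⟩ := (h.isP1Map (n + 1) hn).exists_affineEquiv (h.injOn hn) hσ
  exact ⟨⟨g, g', hg, hg'⟩⟩

/-- The quantity whose `L^∞` norms over `t ∈ (t^n, t^{n+1})` define `α₂^n`. -/
noncomputable def jacMulDivergence (S : Scheme d) (n : ℕ) (t : ℝ) (x : E d) : ℝ :=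
  S.jac n (S.A (S.time n) (S.interpInv n t x)) * divergence (S.meshVel n t) x

namespace StepMaps

variable (p : S.StepMaps n σ)

/-- The derivative of the ALE mapping at time `t^n` on the reference cell. -/
noncomputable def leftLinear : Module.End ℝ (E d) := (p.left : E d →ᵃ[ℝ] E d).linear

/-- The derivative of the ALE mapping at time `t^{n+1}` on the reference cell. -/
noncomputable def rightLinear : Module.End ℝ (E d) := (p.right : E d →ᵃ[ℝ] E d).linear

/-- The constant Jacobian of `A_{t^n, t^{n+1}}` on a cell. -/
noncomputable def jacobian : ℝ := LinearMap.det p.rightLinear / LinearMap.det p.leftLinear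

theorem exists_affineEquiv_interp (h : S.Admissible) (hn : n < S.N) (hσ : σ ∈ S.mesh.cells)
    (ht : t ∈ Icc (S.time n) (S.time (n + 1))) :
    ∃ g : E d ≃ᵃ[ℝ] E d, EqOn (S.interp n t) g (convexHull ℝ (σ : Set (E d))) ∧
      (g : E d →ᵃ[ℝ] E d).linear =
        AffineMap.lineMap p.leftLinear p.rightLinear (S.fraction n t) := by
  let G : E d →ᵃ[ℝ] E d :=
    AffineMap.lineMap (p.left : E d →ᵃ[ℝ] E d) (p.right : E d →ᵃ[ℝ] E d) (S.fraction n t)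
  have hG : EqOn (S.interp n t) G (convexHull ℝ (σ : Set (E d))) := fun Y hY => by
    rw [h.interp_eq_lineMap, p.eqOn_left hY, p.eqOn_right hY]
    simp [G, AffineMap.lineMap_apply]
  have hbij := bijective_affineMap_of_injOn (Triangulation.interior_hull_nonempty hσ)
    (((h.injOn_interp n hn t ht).mono (Triangulation.hull_subset_region hσ)).congr hG)
  refine ⟨AffineEquiv.ofBijective hbij, hG, ?_⟩
  change G.linear = _
  simp only [G, AffineMap.lineMap_apply_module, AffineMap.add_linear, AffineMap.smul_linear]
  rfl

theorem det_lineMap_ne_zero (h : S.Admissible) (hn : n < S.N) (hσ : σ ∈ S.mesh.cells) :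
    ∀ s ∈ Icc (0 : ℝ) 1,
      LinearMap.det (AffineMap.lineMap p.leftLinear p.rightLinear s) ≠ 0 := by
  intro s hs
  have ht : S.time n + s * S.dt ∈ Icc (S.time n) (S.time (n + 1)) := by
    rw [time_succ]
    exact ⟨le_add_of_nonneg_right (mul_nonneg hs.1 h.dt_pos.le),
      add_le_add_right (mul_le_of_le_one_left h.dt_pos.le hs.2) _⟩
  obtain ⟨g, -, hg⟩ := p.exists_affineEquiv_interp h hn hσ ht
  rw [h.fraction_add_mul] at hg
  have hdet := congrArg LinearMap.det (linear_mul_symm_linear g)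
  rw [map_mul, map_one, hg] at hdet
  exact left_ne_zero_of_mul_eq_one hdet

theorem jacobian_pos (h : S.Admissible) (hn : n < S.N) (hσ : σ ∈ S.mesh.cells) :
    0 < p.jacobian :=
  det_div_det_pos (p.det_lineMap_ne_zero h hn hσ)

theorem meshVel_eqOn (h : S.Admissible) (hn : n < S.N) (hσ : σ ∈ S.mesh.cells)
    (ht : t ∈ Icc (S.time n) (S.time (n + 1))) {g : E d ≃ᵃ[ℝ] E d}
    (hg : EqOn (S.interp n t) g (convexHull ℝ (σ : Set (E d)))) :
    EqOn (S.meshVel n t)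
      ((S.dt⁻¹ • ((p.right : E d →ᵃ[ℝ] E d) - (p.left : E d →ᵃ[ℝ] E d))).comp
        (g.symm : E d →ᵃ[ℝ] E d))
      (S.interp n t '' convexHull ℝ (σ : Set (E d))) := by
  rintro _ ⟨Y, hY, rfl⟩
  rw [meshVel, interpInv, (h.injOn_interp n hn t ht).leftInvOn_invFunOn
    (Triangulation.hull_subset_region hσ hY), p.eqOn_left hY, p.eqOn_right hY, hg hY]
  simp

theorem divergence_meshVel (h : S.Admissible) (hn : n < S.N) (hσ : σ ∈ S.mesh.cells)
    (ht : t ∈ Icc (S.time n) (S.time (n + 1))) {g : E d ≃ᵃ[ℝ] E d}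
    (hg : EqOn (S.interp n t) g (convexHull ℝ (σ : Set (E d)))) {x : E d}
    (hx : x ∈ interior (S.interp n t '' convexHull ℝ (σ : Set (E d)))) :
    divergence (S.meshVel n t) x = S.dt⁻¹ * LinearMap.trace ℝ (E d)
      ((p.rightLinear - p.leftLinear) * (g.symm : E d →ᵃ[ℝ] E d).linear) := by
  rw [divergence_congr ((p.meshVel_eqOn h hn hσ ht hg).eventuallyEq_of_mem
    (mem_interior_iff_mem_nhds.1 hx)), divergence_affineMap, AffineMap.comp_linear,
    AffineMap.smul_linear, AffineMap.sub_linear, LinearMap.smul_comp, map_smul, smul_eq_mul]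
  rfl

theorem jac_eq_jacobian (h : S.Admissible) (hn : n < S.N) (hσ : σ ∈ S.mesh.cells) {x : E d}
    (hx : x ∈ interior (S.cell n σ)) : S.jac n x = p.jacobian := by
  rw [jac, ((h.transfer_eqOn hn.le hσ p.eqOn_left p.eqOn_right).eventuallyEq_of_mem
    (mem_interior_iff_mem_nhds.1 hx)).fderiv_eq, (hasFDerivAt_affineMap _ x).fderiv]
  exact det_linear_comp_symm p.left p.right

theorem jac_interpInv (h : S.Admissible) (hn : n < S.N) (hσ : σ ∈ S.mesh.cells)
    (ht : t ∈ Icc (S.time n) (S.time (n + 1))) {g : E d ≃ᵃ[ℝ] E d}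
    (hg : EqOn (S.interp n t) g (convexHull ℝ (σ : Set (E d)))) {x : E d}
    (hx : x ∈ interior (S.interp n t '' convexHull ℝ (σ : Set (E d)))) :
    S.jac n (S.A (S.time n) (S.interpInv n t x)) = p.jacobian := by
  rw [hg.image_eq, ← image_interior_affineEquiv] at hx
  obtain ⟨Y, hY, rfl⟩ := hx
  have hYσ := interior_subset hY
  refine p.jac_eq_jacobian h hn hσ ?_
  rw [interpInv, ← hg hYσ, (h.injOn_interp n hn t ht).leftInvOn_invFunOn
    (Triangulation.hull_subset_region hσ hYσ), cell, p.eqOn_left.image_eq,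
    ← image_interior_affineEquiv, p.eqOn_left hYσ]
  exact mem_image_of_mem _ hY

theorem exists_jacMulDivergence_eq (h : S.Admissible) (hn : n < S.N) (hσ : σ ∈ S.mesh.cells)
    (ht : t ∈ Icc (S.time n) (S.time (n + 1))) :
    ∃ q, AffineMap.lineMap p.leftLinear p.rightLinear (S.fraction n t) * q = 1 ∧
      ∀ x ∈ interior (S.interp n t '' convexHull ℝ (σ : Set (E d))),
        S.jacMulDivergence n t x = p.jacobian *
          (S.dt⁻¹ * LinearMap.trace ℝ (E d) ((p.rightLinear - p.leftLinear) * q)) := by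
  obtain ⟨g, hg, hlin⟩ := p.exists_affineEquiv_interp h hn hσ ht
  refine ⟨(g.symm : E d →ᵃ[ℝ] E d).linear, hlin ▸ linear_mul_symm_linear g, fun x hx => ?_⟩
  rw [jacMulDivergence, p.jac_interpInv h hn hσ ht hg hx, p.divergence_meshVel h hn hσ ht hg hx]

end StepMaps

theorem ae_abs_le_linfty_toReal {s : Set (E d)} {g : E d → ℝ}
    (hg : MemLp g ∞ (volume.restrict s)) :
    ∀ᵐ x ∂(volume.restrict s), |g x| ≤ (linfty s g).toReal := by
  filter_upwards [enorm_ae_le_eLpNormEssSup g (volume.restrict s)] with x hx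
  rw [linfty, ← Real.norm_eq_abs, ← toReal_enorm]
  exact ENNReal.toReal_mono hg.eLpNorm_ne_top (by rwa [eLpNorm_exponent_top])

theorem enorm_le_linfty {s U : Set (E d)} {g : E d → ℝ} {a : ℝ} (hU : IsOpen U)
    (hne : U.Nonempty) (hUs : U ⊆ s) (hg : ∀ x ∈ U, g x = a) : ‖a‖ₑ ≤ linfty s g := by
  have hU₀ : volume.restrict U ≠ 0 := by
    rw [Ne, Measure.restrict_eq_zero]
    exact (hU.measure_pos volume hne).ne'
  have hconst : g =ᵐ[volume.restrict U] fun _ => a := by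
    filter_upwards [ae_restrict_mem hU.measurableSet] with x hx using hg x hx
  calc ‖a‖ₑ = eLpNorm g ∞ (volume.restrict U) := by
        rw [eLpNorm_congr_ae hconst, eLpNorm_exponent_top, eLpNormEssSup_const a hU₀]
    _ ≤ linfty s g := eLpNorm_mono_measure _ (Measure.restrict_mono hUs le_rfl)

theorem alpha1_nonneg (S : Scheme d) (n : ℕ) : 0 ≤ S.alpha1 n := ENNReal.toReal_nonneg

theorem alpha2_nonneg (S : Scheme d) (n : ℕ) : 0 ≤ S.alpha2 n := by
  unfold alpha2
  split_ifs
  exacts [ENNReal.toReal_nonneg, le_rfl]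

namespace Admissible

theorem exists_abs_jacMulDivergence_le (h : S.Admissible) (hn : n < S.N)
    (hσ : σ ∈ S.mesh.cells) :
    ∃ C, ∀ t ∈ Ioo (S.time n) (S.time (n + 1)),
      ∀ x ∈ interior (S.interp n t '' convexHull ℝ (σ : Set (E d))),
        |S.jacMulDivergence n t x| ≤ C := by
  obtain ⟨p⟩ := h.nonempty_stepMaps hn hσ
  obtain ⟨C, hC⟩ := exists_abs_trace_le (p.det_lineMap_ne_zero h hn hσ)
  refine ⟨|p.jacobian| * (|S.dt⁻¹| * C), fun t ht x hx => ?_⟩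
  have ht' := Ioo_subset_Icc_self ht
  obtain ⟨q, hq, hval⟩ := p.exists_jacMulDivergence_eq h hn hσ ht'
  rw [hval x hx, abs_mul, abs_mul]
  gcongr
  exact hC _ (h.fraction_mem_Icc ht') q hq

theorem iSup_linfty_ne_top (h : S.Admissible) (hn : n < S.N) :
    (⨆ t ∈ Ioo (S.time n) (S.time (n + 1)), linfty (S.domAt n t) (S.jacMulDivergence n t)) ≠
      ∞ := by
  have hbound : ∀ σ ∈ S.mesh.cells, ∃ C, ∀ t ∈ Ioo (S.time n) (S.time (n + 1)),
      ∀ x ∈ interior (S.interp n t '' convexHull ℝ (σ : Set (E d))),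
        |S.jacMulDivergence n t x| ≤ C := fun _ => h.exists_abs_jacMulDivergence_le hn
  choose! C hC using hbound
  refine ne_top_of_le_ne_top (ENNReal.ofReal_ne_top (r := ∑ σ ∈ S.mesh.cells, |C σ|))
    (iSup₂_le fun t ht => ?_)
  have hcells := (h.isP1Map_interp hn t).isCellFamily
    (h.injOn_interp n hn t (Ioo_subset_Icc_self ht))
  rw [linfty, eLpNorm_exponent_top]
  refine eLpNormEssSup_le_of_ae_bound ?_
  rw [domAt, Triangulation.image_region]
  filter_upwards [hcells.ae_mem_interior] with x ⟨σ, hσ, hx⟩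
  exact ((hC σ hσ t ht x hx).trans (le_abs_self _)).trans
    (Finset.single_le_sum (f := fun σ => |C σ|) (fun _ _ => abs_nonneg _) hσ)

theorem abs_le_alpha2 (h : S.Admissible) (hn : n < S.N)
    (ht : t ∈ Ioo (S.time n) (S.time (n + 1))) (hσ : σ ∈ S.mesh.cells) {a : ℝ}
    (ha : ∀ x ∈ interior (S.interp n t '' convexHull ℝ (σ : Set (E d))),
      S.jacMulDivergence n t x = a) : |a| ≤ S.alpha2 n := by
  obtain ⟨g, hg⟩ := (h.isP1Map_interp hn t).exists_affineEquiv
    (h.injOn_interp n hn t (Ioo_subset_Icc_self ht)) hσ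
  have hne : (interior (S.interp n t '' convexHull ℝ (σ : Set (E d)))).Nonempty := by
    rw [hg.image_eq, ← image_interior_affineEquiv]
    exact (Triangulation.interior_hull_nonempty hσ).image _
  have hle : ‖a‖ₑ ≤ linfty (S.domAt n t) (S.jacMulDivergence n t) :=
    enorm_le_linfty isOpen_interior hne
      (interior_mono (image_mono (Triangulation.hull_subset_region hσ))) ha
  rw [alpha2, if_pos hn, ← Real.norm_eq_abs, ← toReal_enorm]
  exact ENNReal.toReal_mono (h.iSup_linfty_ne_top hn) (hle.trans (le_iSup₂_of_le t ht le_rfl))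

end Admissible

theorem StepMaps.jacobian_le (p : S.StepMaps n σ) (h : S.Admissible) (hn : n < S.N)
    (hσ : σ ∈ S.mesh.cells) : p.jacobian ≤ 1 + S.dt * S.alpha2 n := by
  have hdt := h.dt_pos
  obtain ⟨s, hs, hJ⟩ := exists_det_div_det_sub_one_le (p.det_lineMap_ne_zero h hn hσ)
  have ht : S.time n + s * S.dt ∈ Ioo (S.time n) (S.time (n + 1)) := by
    rw [time_succ]
    exact ⟨lt_add_of_pos_right _ (mul_pos hs.1 hdt),
      add_lt_add_right (mul_lt_of_lt_one_left hdt hs.2) _⟩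
  obtain ⟨q, hq, hval⟩ := p.exists_jacMulDivergence_eq h hn hσ (Ioo_subset_Icc_self ht)
  rw [h.fraction_add_mul] at hq
  calc p.jacobian ≤ 1 + |p.jacobian *
          LinearMap.trace ℝ (E d) ((p.rightLinear - p.leftLinear) * q)| :=
        sub_le_iff_le_add'.1 (hJ q hq)
    _ = 1 + S.dt * |p.jacobian * (S.dt⁻¹ *
          LinearMap.trace ℝ (E d) ((p.rightLinear - p.leftLinear) * q))| := by
        rw [mul_left_comm, abs_mul S.dt⁻¹, abs_of_pos (inv_pos.2 hdt),
          mul_inv_cancel_left₀ hdt.ne']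
    _ ≤ 1 + S.dt * S.alpha2 n := by
        gcongr
        exact h.abs_le_alpha2 hn ht hσ hval

end Scheme

/-! ### Finite element functions -/

theorem memLp_inner {α V : Type*} [MeasurableSpace α] {ν : Measure α} [NormedAddCommGroup V]
    [InnerProductSpace ℝ V] {p q r : ℝ≥0∞} [ENNReal.HolderTriple p q r] {F G : α → V}
    (hF : MemLp F p ν) (hG : MemLp G q ν) : MemLp (fun x => inner ℝ (F x) (G x)) r ν :=
  (hG.norm.mul' hF.norm).of_le (hF.1.inner hG.1) <| Eventually.of_forall fun x => by
    simpa using abs_real_inner_le_norm (F x) (G x)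

theorem piecewiseContinuous_of_lipschitzOnWith {ι V F : Type*} [NormedAddCommGroup V]
    [NormedAddCommGroup F] [NormedSpace ℝ F] [FiniteDimensional ℝ F] {s : Finset ι}
    {K : ι → Set V} {g : V → F} {C : ℝ≥0}
    (hg : LipschitzOnWith C g (interior (⋃ i ∈ s, K i))) : PiecewiseContinuous s K g := by
  obtain ⟨G, hG, hgG⟩ := hg.extend_finite_dimension
  exact fun i hi => ⟨G, hG.continuous, hgG.mono (interior_subset_interior_biUnion hi)⟩

namespace Scheme

variable {d : ℕ} {S : Scheme d} {n : ℕ} {σ : Finset (E d)} {v : E d → ℝ} {q : ℝ≥0∞}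

namespace Admissible

theorem restrict_cell_le (h : S.Admissible) (hn : n ≤ S.N) (hσ : σ ∈ S.mesh.cells) :
    volume.restrict (S.cell n σ) ≤ volume.restrict (S.dom n) :=
  dom_eq S n ▸ (h.isCellFamily hn).restrict_cell_le hσ

theorem setIntegral_dom_eq_sum (h : S.Admissible) (hn : n ≤ S.N) {g : E d → ℝ}
    (hg : IntegrableOn g (S.dom n)) :
    ∫ x in S.dom n, g x = ∑ σ ∈ S.mesh.cells, ∫ x in S.cell n σ, g x := by
  rw [dom_eq] at hg ⊢
  exact (h.isCellFamily hn).setIntegral_eq_sum hg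

theorem memLp {F : Type*} [NormedAddCommGroup F] (h : S.Admissible) (hn : n ≤ S.N)
    {g : E d → F} (hg : PiecewiseContinuous S.mesh.cells (S.cell n) g) :
    MemLp g q (volume.restrict (S.dom n)) :=
  dom_eq S n ▸ hg.memLp (h.isCellFamily hn)

theorem memLp_b (h : S.Admissible) (hn : n ≤ S.N) {L : ℝ≥0}
    (hb : LipschitzOnWith L (S.b (S.time n)) (S.dom n)) :
    MemLp (S.b (S.time n)) q (volume.restrict (S.dom n)) :=
  h.memLp hn (piecewiseContinuous_of_lipschitzOnWith (dom_eq S n ▸ hb))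

theorem exists_w_eqOn (h : S.Admissible) (hn : n < S.N) (hσ : σ ∈ S.mesh.cells) :
    ∃ W : E d →ᵃ[ℝ] E d, EqOn (S.w (n + 1)) W (S.cell (n + 1) σ) := by
  obtain ⟨p⟩ := h.nonempty_stepMaps hn hσ
  have ht := right_mem_Icc.2 (h.time_le_time_succ n)
  obtain ⟨g, hg, -⟩ := p.exists_affineEquiv_interp h hn hσ ht
  have hw := p.meshVel_eqOn h hn hσ ht hg
  rw [h.interp_right] at hw
  exact ⟨_, hw⟩

theorem memLp_w (h : S.Admissible) (hn : n < S.N) :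
    MemLp (S.w (n + 1)) q (volume.restrict (S.dom (n + 1))) :=
  h.memLp hn fun _ hσ => by
    obtain ⟨W, hW⟩ := h.exists_w_eqOn hn hσ
    exact ⟨W, W.continuous_of_finiteDimensional, hW.mono interior_subset⟩

theorem memLp_divergence_w (h : S.Admissible) (hn : n < S.N) :
    MemLp (divergence (S.w (n + 1))) q (volume.restrict (S.dom (n + 1))) :=
  h.memLp hn fun _ hσ => by
    obtain ⟨W, hW⟩ := h.exists_w_eqOn hn hσ
    refine ⟨fun _ => LinearMap.trace ℝ (E d) W.linear, continuous_const, fun x hx => ?_⟩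
    rw [divergence_congr (hW.eventuallyEq_of_mem (mem_interior_iff_mem_nhds.1 hx)),
      divergence_affineMap]

theorem ae_differentiableAt_w (h : S.Admissible) (hn : n < S.N) :
    ∀ᵐ x ∂(volume.restrict (S.dom (n + 1))), DifferentiableAt ℝ (S.w (n + 1)) x := by
  rw [dom_eq]
  filter_upwards [(h.isCellFamily hn).ae_mem_interior] with x ⟨σ, hσ, hx⟩
  obtain ⟨W, hW⟩ := h.exists_w_eqOn hn hσ
  exact (hasFDerivAt_affineMap W x).differentiableAt.congr_of_eventuallyEq
    (hW.eventuallyEq_of_mem (mem_interior_iff_mem_nhds.1 hx))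

theorem memLp_relVel (h : S.Admissible) (hn : n < S.N)
    {L : ℝ≥0} (hb : LipschitzOnWith L (S.b (S.time (n + 1))) (S.dom (n + 1))) :
    MemLp (S.relVel (n + 1)) q (volume.restrict (S.dom (n + 1))) :=
  (h.memLp_b hn hb).sub (h.memLp_w hn)

end Admissible

namespace InVh

theorem exists_contDiff (hv : S.InVh n v) (hσ : σ ∈ S.mesh.cells) :
    ∃ P : E d → ℝ, ContDiff ℝ 2 P ∧ EqOn v P (S.cell n σ) := by
  obtain ⟨p, -, hp⟩ := hv.2.2 σ hσ
  have hP := AnalyticOnNhd.eval_continuousLinearMap' (𝕜 := ℝ)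
    (fun i : Fin d => (EuclideanSpace.proj i : E d →L[ℝ] ℝ)) p
  exact ⟨_, contDiffOn_univ.1 (hP.contDiffOn uniqueDiffOn_univ), hp⟩

theorem memLp (hv : S.InVh n v) (h : S.Admissible) (hn : n ≤ S.N) :
    MemLp v q (volume.restrict (S.dom n)) :=
  h.memLp hn fun _ hσ => by
    obtain ⟨P, hP, hvP⟩ := hv.exists_contDiff hσ
    exact ⟨P, hP.continuous, hvP.mono interior_subset⟩

theorem memLp_gradient (hv : S.InVh n v) (h : S.Admissible) (hn : n ≤ S.N) :
    MemLp (gradient v) q (volume.restrict (S.dom n)) :=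
  h.memLp hn fun _ hσ => by
    obtain ⟨P, hP, hvP⟩ := hv.exists_contDiff hσ
    refine ⟨gradient P,
      (LinearIsometryEquiv.continuous _).comp (hP.continuous_fderiv (by norm_num)), fun x hx => ?_⟩
    exact (hvP.eventuallyEq_of_mem (mem_interior_iff_mem_nhds.1 hx)).gradient_eq

theorem memLp_laplacian (hv : S.InVh n v) (h : S.Admissible) (hn : n ≤ S.N) :
    MemLp (Laplacian.laplacian v) q (volume.restrict (S.dom n)) :=
  h.memLp hn fun _ hσ => by
    obtain ⟨P, hP, hvP⟩ := hv.exists_contDiff hσ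
    refine ⟨Laplacian.laplacian P, ?_, fun x hx => ?_⟩
    · rw [InnerProductSpace.laplacian_eq_iteratedFDeriv_stdOrthonormalBasis]
      exact continuous_finsetSum _ fun i _ =>
        (ContinuousMultilinearMap.apply ℝ (fun _ : Fin 2 => E d) ℝ _).continuous.comp
          (hP.continuous_iteratedFDeriv le_rfl)
    · exact (InnerProductSpace.laplacian_congr_nhds
        (hvP.eventuallyEq_of_mem (mem_interior_iff_mem_nhds.1 hx))).self_of_nhds

theorem ae_differentiableAt (hv : S.InVh n v) (h : S.Admissible) (hn : n ≤ S.N) :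
    ∀ᵐ x ∂(volume.restrict (S.dom n)), DifferentiableAt ℝ v x := by
  rw [dom_eq]
  filter_upwards [(h.isCellFamily hn).ae_mem_interior] with x ⟨σ, hσ, hx⟩
  obtain ⟨P, hP, hvP⟩ := hv.exists_contDiff hσ
  exact (hP.differentiable (by norm_num) x).congr_of_eventuallyEq
    (hvP.eventuallyEq_of_mem (mem_interior_iff_mem_nhds.1 hx))

theorem exists_lipschitzOnWith (hv : S.InVh n v) (h : S.Admissible) (hn : n ≤ S.N)
    (hσ : σ ∈ S.mesh.cells) : ∃ C : ℝ≥0, LipschitzOnWith C v (S.cell n σ) := by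
  obtain ⟨P, hP, hvP⟩ := hv.exists_contDiff hσ
  have hcells := h.isCellFamily hn
  obtain ⟨C, hC⟩ := (hP.contDiffOn (s := S.cell n σ)).exists_lipschitzOnWith (by norm_num)
    (hcells.convex σ hσ) (hcells.isCompact σ hσ)
  exact ⟨C, lipschitzOnWith_congr hC hvP⟩

theorem memLp_transfer (hv : S.InVh n v) (h : S.Admissible) (hn : n < S.N) :
    MemLp (fun x => v (S.transfer (n + 1) n x)) q (volume.restrict (S.dom (n + 1))) :=
  h.memLp hn fun σ hσ => by
    obtain ⟨P, hP, hvP⟩ := hv.exists_contDiff hσ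
    obtain ⟨p⟩ := h.nonempty_stepMaps hn hσ
    let B := (p.left : E d →ᵃ[ℝ] E d).comp (p.right.symm : E d →ᵃ[ℝ] E d)
    have hB : EqOn (S.transfer (n + 1) n) B (S.cell (n + 1) σ) :=
      h.transfer_eqOn hn hσ p.eqOn_right p.eqOn_left
    have hmaps : MapsTo B (S.cell (n + 1) σ) (S.cell n σ) := by
      rintro _ ⟨Y, hY, rfl⟩
      exact ⟨Y, hY, by simp [B, p.eqOn_left hY, p.eqOn_right hY]⟩
    refine ⟨P ∘ B, hP.continuous.comp B.continuous_of_finiteDimensional, fun x hx => ?_⟩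
    have hxσ := interior_subset hx
    simp only [hB hxσ, hvP (hmaps hxσ), Function.comp_apply]

end InVh

theorem StepMaps.setIntegral_transfer (p : S.StepMaps n σ) (h : S.Admissible) (hn : n < S.N)
    (hσ : σ ∈ S.mesh.cells) (φ : E d → ℝ) :
    ∫ x in S.cell (n + 1) σ, φ (S.transfer (n + 1) n x) =
      p.jacobian * ∫ x in S.cell n σ, φ x := by
  let G := (p.right : E d →ᵃ[ℝ] E d).comp (p.left.symm : E d →ᵃ[ℝ] E d)
  have hcell : S.cell (n + 1) σ = G '' S.cell n σ := by
    rw [cell, cell, p.eqOn_left.image_eq, p.eqOn_right.image_eq, image_image]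
    exact image_congr fun Y _ => by simp [G]
  have hmeas : MeasurableSet (S.cell n σ) :=
    ((h.isCellFamily hn.le).isCompact σ hσ).measurableSet
  have hinj : InjOn G (S.cell n σ) := fun x _ y _ hxy => by simpa [G] using hxy
  have hdet : |(LinearMap.toContinuousLinearMap G.linear).det| = p.jacobian :=
    (congrArg abs (det_linear_comp_symm p.left p.right)).trans
      (abs_of_pos (p.jacobian_pos h hn hσ))
  rw [hcell, integral_image_eq_integral_abs_det_fderiv_smul volume hmeas
    (fun x _ => (hasFDerivAt_affineMap G x).hasFDerivWithinAt) hinj, hdet, integral_smul,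
    smul_eq_mul]
  congr 1
  refine setIntegral_congr_fun hmeas fun x hx => ?_
  have hGx : G x ∈ S.cell (n + 1) σ := hcell ▸ mem_image_of_mem _ hx
  rw [h.transfer_eqOn hn hσ p.eqOn_right p.eqOn_left hGx]
  simp [G]

theorem InVh.l2sq_transfer_le (hv : S.InVh n v) (h : S.Admissible) (hn : n < S.N) :
    l2sq (S.dom (n + 1)) (fun x => v (S.transfer (n + 1) n x)) ≤
      (1 + S.dt * S.alpha2 n) * l2sq (S.dom n) v := by
  have hint := (hv.memLp h hn.le).integrable_sq
  have hint' := (hv.memLp_transfer h hn).integrable_sq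
  rw [l2sq, l2sq, h.setIntegral_dom_eq_sum hn.le hint, h.setIntegral_dom_eq_sum hn hint',
    Finset.mul_sum]
  refine Finset.sum_le_sum fun σ hσ => ?_
  obtain ⟨p⟩ := h.nonempty_stepMaps hn hσ
  rw [p.setIntegral_transfer h hn hσ fun x => v x ^ 2]
  exact mul_le_mul_of_nonneg_right (p.jacobian_le h hn hσ) (integral_nonneg fun _ => sq_nonneg _)

/-! ### Integration by parts on the moving domain -/

theorem InVh.exists_lipschitzWith_indicator_sq_smul_relVel (hv : S.InVh (n + 1) v)
    (h : S.Admissible) (hn : n < S.N) {L : ℝ≥0}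
    (hb : LipschitzOnWith L (S.b (S.time (n + 1))) (S.dom (n + 1))) :
    ∃ C : ℝ≥0, LipschitzWith C
      ((S.dom (n + 1)).indicator fun x => v x ^ 2 • S.relVel (n + 1) x) := by
  obtain ⟨b, hb', hbeq⟩ := hb.extend_finite_dimension
  have hcells := h.isCellFamily (n := n + 1) hn
  let F : E d → E d := fun x => v x • v x • (b x - S.w (n + 1) x)
  have hzero : ∀ x ∈ frontier (S.closedDom (n + 1)), F x = 0 := fun x hx => by
    simp [F, hv.2.1 x hx]
  have hindicator : (S.dom (n + 1)).indicator (fun x => v x ^ 2 • S.relVel (n + 1) x) =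
      (S.closedDom (n + 1)).indicator F := by
    ext1 x
    by_cases hx : x ∈ S.dom (n + 1)
    · simp [hx, interior_subset hx, relVel, hbeq hx, F, sq, mul_smul]
    · by_cases hx' : x ∈ S.closedDom (n + 1)
      · simp [hx, hx', hzero x ⟨subset_closure hx', hx⟩]
      · simp [hx, hx']
  rw [hindicator, closedDom_eq]
  refine exists_lipschitzWith_indicator (fun σ hσ => (hcells.isCompact σ hσ).isClosed)
    (closedDom_eq S (n + 1) ▸ hzero) fun σ hσ => ?_
  obtain ⟨W, hW⟩ := h.exists_w_eqOn hn hσ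
  obtain ⟨C, hC⟩ := exists_lipschitzWith_affineMap W
  have hvL := hv.exists_lipschitzOnWith h hn hσ
  have hK := hcells.isCompact σ hσ
  exact exists_lipschitzOnWith_smul hK hvL (exists_lipschitzOnWith_smul hK hvL
    ⟨_, hb'.lipschitzOnWith.sub (lipschitzOnWith_congr hC.lipschitzOnWith hW)⟩)

theorem InVh.integral_divergence_sq_smul_relVel (hv : S.InVh (n + 1) v) (h : S.Admissible)
    (hn : n < S.N) {L : ℝ≥0} (hb : LipschitzOnWith L (S.b (S.time (n + 1))) (S.dom (n + 1))) :
    ∫ x in S.dom (n + 1), (2 * (inner ℝ (S.relVel (n + 1) x) (gradient v x) * v x) +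
      (divergence (S.b (S.time (n + 1))) x - divergence (S.w (n + 1)) x) * v x ^ 2) = 0 := by
  have hcells := h.isCellFamily (n := n + 1) hn
  obtain ⟨C, hC⟩ := hv.exists_lipschitzWith_indicator_sq_smul_relVel h hn hb
  have hbounded : Bornology.IsBounded (S.dom (n + 1)) :=
    (closedDom_eq S (n + 1) ▸ hcells.isCompact_biUnion.isBounded).subset interior_subset
  have hfrontier : volume (frontier (S.dom (n + 1))) = 0 :=
    dom_eq S (n + 1) ▸ hcells.measure_frontier_interior_biUnion
  rw [← setIntegral_divergence_eq_zero isOpen_interior hbounded hfrontier hC]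
  refine integral_congr_ae ?_
  filter_upwards [ae_differentiableAt_of_lipschitzOnWith isOpen_interior hb,
    h.ae_differentiableAt_w hn, hv.ae_differentiableAt h hn] with x hbx hwx hvx
  have hrel : DifferentiableAt ℝ (S.relVel (n + 1)) x := hbx.sub hwx
  have hdiv : divergence (S.relVel (n + 1)) x =
      divergence (S.b (S.time (n + 1))) x - divergence (S.w (n + 1)) x := divergence_sub hbx hwx
  rw [divergence_sq_smul hvx hrel, hdiv]

end Scheme

/-! ### A discrete Gronwall inequality -/

theorem le_mul_exp_of_le_add_mul {r X Y : ℝ} (hr : r < 1) (hY : 0 ≤ Y) (h : X ≤ Y + r * X) :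
    X ≤ Y * Real.exp (r / (1 - r)) := by
  have hr' : 0 < 1 - r := sub_pos.2 hr
  calc X ≤ Y / (1 - r) := (le_div_iff₀' hr').2 (by linarith)
    _ = Y * (r / (1 - r) + 1) := by field_simp; ring
    _ ≤ Y * Real.exp (r / (1 - r)) :=
      mul_le_mul_of_nonneg_left (Real.add_one_le_exp _) hY

theorem implicit_discrete_gronwall {X F r : ℕ → ℝ} {n : ℕ} (hX : 0 ≤ X 0)
    (hF : ∀ i ∈ Finset.Icc 1 n, 0 ≤ F i) (hr : ∀ i ∈ Finset.Icc 1 n, 0 ≤ r i)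
    (hr_lt : ∀ i ∈ Finset.Icc 1 n, r i < 1)
    (hstep : ∀ i < n, X (i + 1) ≤ X i + F (i + 1) + r (i + 1) * X (i + 1)) :
    X n ≤ (X 0 + ∑ i ∈ Finset.Icc 1 n, F i) *
      Real.exp (∑ i ∈ Finset.Icc 1 n, r i / (1 - r i)) := by
  induction n with
  | zero => simp
  | succ k ih =>
    have hsub : Finset.Icc 1 k ⊆ Finset.Icc 1 (k + 1) := Finset.Icc_subset_Icc_right k.le_succ
    have hmem : k + 1 ∈ Finset.Icc 1 (k + 1) := by simp
    specialize ih (fun i hi => hF i (hsub hi)) (fun i hi => hr i (hsub hi))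
      (fun i hi => hr_lt i (hsub hi)) (fun i hi => hstep i (hi.trans k.lt_succ_self))
    have hexp : 1 ≤ Real.exp (∑ i ∈ Finset.Icc 1 k, r i / (1 - r i)) :=
      Real.one_le_exp <| Finset.sum_nonneg fun i hi =>
        div_nonneg (hr i (hsub hi)) (sub_nonneg.2 (hr_lt i (hsub hi)).le)
    have hdata : 0 ≤ X 0 + (∑ i ∈ Finset.Icc 1 k, F i + F (k + 1)) :=
      add_nonneg hX (add_nonneg (Finset.sum_nonneg fun i hi => hF i (hsub hi)) (hF _ hmem))
    rw [Finset.sum_Icc_succ_top (Nat.le_add_left 1 k),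
      Finset.sum_Icc_succ_top (Nat.le_add_left 1 k), Real.exp_add, ← mul_assoc]
    refine le_mul_exp_of_le_add_mul (hr_lt _ hmem)
      (mul_nonneg hdata (zero_le_one.trans hexp)) ((hstep k k.lt_succ_self).trans ?_)
    gcongr
    rw [← add_assoc, add_mul]
    exact add_le_add ih (le_mul_of_one_le_right (hF _ hmem) hexp)

/-! ### The energy estimate of one time step -/

section Integrals

variable {α : Type*} [MeasurableSpace α] {ν : Measure α}

theorem integral_sq_sub_integral_sq_div_le {v w : α → ℝ} {τ : ℝ} (hτ : 0 < τ) (hv : MemLp v 2 ν)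
    (hw : MemLp w 2 ν) :
    (∫ x, v x ^ 2 ∂ν - ∫ x, w x ^ 2 ∂ν) / (2 * τ) ≤ ∫ x, (v x - w x) / τ * v x ∂ν := by
  have hquot : MemLp (fun x => (v x - w x) / τ) 2 ν := by
    simpa only [div_eq_mul_inv, Pi.sub_apply] using (hv.sub hw).mul_const τ⁻¹
  rw [← integral_sub hv.integrable_sq hw.integrable_sq, ← integral_div]
  refine integral_mono ((hv.integrable_sq.sub hw.integrable_sq).div_const _)
    (hquot.integrable_mul hv) fun x => ?_
  rw [div_mul_eq_mul_div, div_le_div_iff₀ (by positivity) hτ]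
  nlinarith [mul_nonneg hτ.le (sq_nonneg (v x - w x))]

theorem integral_mul_le_of_memLp_two {f v : α → ℝ} {μ : ℝ} (hμ : 0 < μ) (hf : MemLp f 2 ν)
    (hv : MemLp v 2 ν) :
    ∫ x, f x * v x ∂ν ≤ 1 / μ * ∫ x, f x ^ 2 ∂ν + μ / 4 * ∫ x, v x ^ 2 ∂ν := by
  have hf' := hf.integrable_sq.const_mul (1 / μ)
  have hv' := hv.integrable_sq.const_mul (μ / 4)
  rw [← integral_const_mul, ← integral_const_mul, ← integral_add hf' hv']
  refine integral_mono (hf.integrable_mul hv) (hf'.add hv') fun x => ?_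
  have hsq : 0 ≤ (f x - μ / 2 * v x) ^ 2 / μ := by positivity
  have hexpand : (f x - μ / 2 * v x) ^ 2 / μ =
      1 / μ * f x ^ 2 + μ / 4 * v x ^ 2 - f x * v x := by
    field_simp
    ring
  linarith

theorem integral_residual_mul_sub_ge {l Z r f : α → ℝ} {ε : ℝ} (hl : MemLp l 2 ν)
    (hZ : MemLp Z 2 ν) (hr : MemLp r 2 ν) (hf : MemLp f 2 ν) :
    1 / 4 * ∫ x, Z x ^ 2 ∂ν - ε ^ 2 * ∫ x, l x ^ 2 ∂ν - ∫ x, r x ^ 2 ∂ν - ∫ x, f x ^ 2 ∂ν ≤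
      ∫ x, (-ε * l x + Z x + r x) * Z x ∂ν - ∫ x, f x * Z x ∂ν := by
  have hres : Integrable (fun x => (-ε * l x + Z x + r x) * Z x) ν :=
    (((hl.const_mul (-ε)).add hZ).add hr).integrable_mul hZ
  have hfZ : Integrable (fun x => f x * Z x) ν := hf.integrable_mul hZ
  have hZ' := hZ.integrable_sq.const_mul (1 / 4)
  have hl' := hl.integrable_sq.const_mul (ε ^ 2)
  have hZl : Integrable (fun x => 1 / 4 * Z x ^ 2 - ε ^ 2 * l x ^ 2) ν := hZ'.sub hl'
  have hZlr : Integrable (fun x => 1 / 4 * Z x ^ 2 - ε ^ 2 * l x ^ 2 - r x ^ 2) ν :=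
    hZl.sub hr.integrable_sq
  rw [← integral_const_mul, ← integral_const_mul, ← integral_sub hZ' hl',
    ← integral_sub hZl hr.integrable_sq, ← integral_sub hZlr hf.integrable_sq,
    ← integral_sub hres hfZ]
  refine integral_mono (hZlr.sub hf.integrable_sq) (hres.sub hfZ) fun x => ?_
  nlinarith [sq_nonneg (ε * l x - Z x / 2), sq_nonneg (r x + Z x / 2), sq_nonneg (f x - Z x / 2)]

theorem integrable_mul_sq {g v : α → ℝ} (hg : MemLp g ∞ ν) (hv : MemLp v 2 ν) :
    Integrable (fun x => g x * v x ^ 2) ν :=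
  memLp_one_iff_integrable.1 ((memLp_one_iff_integrable.2 hv.integrable_sq).mul' hg)

theorem l2sq_nonneg {d : ℕ} (s : Set (E d)) (g : E d → ℝ) : 0 ≤ l2sq s g :=
  integral_nonneg fun x => sq_nonneg (g x)

theorem l2sq_mul_le {d : ℕ} {s : Set (E d)} {g v : E d → ℝ}
    (hg : MemLp g ∞ (volume.restrict s)) (hv : MemLp v 2 (volume.restrict s)) :
    l2sq s (fun x => g x * v x) ≤ (linfty s g).toReal ^ 2 * l2sq s v := by
  have hgv : MemLp (fun x => g x * v x) 2 (volume.restrict s) := hv.mul' hg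
  rw [l2sq, l2sq, ← integral_const_mul]
  refine integral_mono_ae hgv.integrable_sq (hv.integrable_sq.const_mul _) ?_
  filter_upwards [Scheme.ae_abs_le_linfty_toReal hg] with x hx
  rw [mul_pow, ← sq_abs (g x)]
  gcongr

end Integrals

namespace Scheme

/-- The assumptions on the coefficients, the source term and the stabilization parameters at the
time `t^n`, with coercivity constant `μ` and inverse constant `cinv`. The diffusive bound
`δ_K ≤ h_K² / (2 ε cinv²)` is multiplied out, so that it is meaningful for `ε = 0`. -/
structure StableAt {d : ℕ} (S : Scheme d) (μ cinv : ℝ) (n : ℕ) : Prop where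
  lipschitz_b : ∃ L : ℝ≥0, LipschitzOnWith L (S.b (S.time n)) (S.dom n)
  memLp_c : MemLp (S.c (S.time n)) ∞ (volume.restrict (S.dom n))
  memLp_f : MemLp (S.f (S.time n)) 2 (volume.restrict (S.dom n))
  le_reaction : ∀ᵐ x ∂(volume.restrict (S.dom n)),
    μ ≤ S.c (S.time n) x - 1 / 2 * divergence (S.b (S.time n)) x
  δ_nonneg : ∀ σ ∈ S.mesh.cells, 0 ≤ S.δ n σ
  δ_reaction_le : ∀ σ ∈ S.mesh.cells,
    S.δ n σ * (2 * (linfty (S.cell n σ) (S.c (S.time n))).toReal ^ 2) ≤ μ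
  δ_diffusion_le : ∀ σ ∈ S.mesh.cells,
    S.δ n σ * (2 * S.eps * cinv ^ 2) ≤ Metric.diam (S.cell n σ) ^ 2
  δ_le_dt : ∀ σ ∈ S.mesh.cells, S.δ n σ ≤ S.dt / 4

variable {d : ℕ} {S : Scheme d} {n : ℕ} {σ : Finset (E d)} {v : E d → ℝ} {μ cinv : ℝ}

theorem supgNormSq_nonneg (hμ : 0 ≤ μ) (heps : 0 ≤ S.eps)
    (hδ : ∀ σ ∈ S.mesh.cells, 0 ≤ S.δ n σ) (v : E d → ℝ) : 0 ≤ S.supgNormSq μ n v :=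
  add_nonneg (add_nonneg (mul_nonneg heps (integral_nonneg fun _ => sq_nonneg _))
    (Finset.sum_nonneg fun σ hσ => mul_nonneg (hδ σ hσ) (l2sq_nonneg _ _)))
    (mul_nonneg hμ (l2sq_nonneg _ _))

theorem Admissible.integrable_divergence_sub_mul_sq (h : S.Admissible) (hn : n < S.N) {L : ℝ≥0}
    (hb : LipschitzOnWith L (S.b (S.time (n + 1))) (S.dom (n + 1)))
    (hv : MemLp v 2 (volume.restrict (S.dom (n + 1)))) :
    Integrable (fun x =>
      (divergence (S.b (S.time (n + 1))) x - divergence (S.w (n + 1)) x) * v x ^ 2)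
      (volume.restrict (S.dom (n + 1))) :=
  integrable_mul_sq ((memLp_top_divergence isOpen_interior hb).sub (h.memLp_divergence_w hn)) hv

theorem InVh.integral_inner_relVel_gradient_mul (hv : S.InVh (n + 1) v) (h : S.Admissible)
    (hn : n < S.N) {L : ℝ≥0} (hb : LipschitzOnWith L (S.b (S.time (n + 1))) (S.dom (n + 1))) :
    ∫ x in S.dom (n + 1), inner ℝ (S.relVel (n + 1) x) (gradient v x) * v x =
      -(1 / 2) * ∫ x in S.dom (n + 1),
        (divergence (S.b (S.time (n + 1))) x - divergence (S.w (n + 1)) x) * v x ^ 2 := by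
  have hv2 := hv.memLp (q := 2) h hn
  have hconv : Integrable (fun x => inner ℝ (S.relVel (n + 1) x) (gradient v x) * v x)
      (volume.restrict (S.dom (n + 1))) :=
    (memLp_inner (r := 2) (h.memLp_relVel (q := ∞) hn hb)
      (hv.memLp_gradient (q := 2) h hn)).integrable_mul hv2
  have hibp := hv.integral_divergence_sq_smul_relVel h hn hb
  rw [integral_add (hconv.const_mul 2) (h.integrable_divergence_sub_mul_sq hn hb hv2),
    integral_const_mul] at hibp
  linarith

theorem InVh.convection_reaction_ge (hv : S.InVh (n + 1) v) (h : S.Admissible) (hn : n < S.N)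
    (hS : S.StableAt μ cinv (n + 1)) :
    (μ - S.alpha1 (n + 1) / 2) * l2sq (S.dom (n + 1)) v ≤
      (∫ x in S.dom (n + 1), inner ℝ (S.b (S.time (n + 1)) x) (gradient v x) * v x) +
        (∫ x in S.dom (n + 1), S.c (S.time (n + 1)) x * v x * v x) -
        ∫ x in S.dom (n + 1), inner ℝ (S.w (n + 1) x) (gradient v x) * v x := by
  obtain ⟨L, hb⟩ := hS.lipschitz_b
  have hv2 := hv.memLp (q := 2) h hn
  have hg2 := hv.memLp_gradient (q := 2) h hn
  have hbv := (memLp_inner (r := 2) (h.memLp_b (q := ∞) hn hb) hg2).integrable_mul hv2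
  have hwv := (memLp_inner (r := 2) (h.memLp_w (q := ∞) hn) hg2).integrable_mul hv2
  have hcv := integrable_mul_sq hS.memLp_c hv2
  have hdiv := (h.integrable_divergence_sub_mul_sq hn hb hv2).const_mul (1 / 2)
  have hrel : (∫ x in S.dom (n + 1), inner ℝ (S.b (S.time (n + 1)) x) (gradient v x) * v x) -
      ∫ x in S.dom (n + 1), inner ℝ (S.w (n + 1) x) (gradient v x) * v x =
        ∫ x in S.dom (n + 1), inner ℝ (S.relVel (n + 1) x) (gradient v x) * v x := by
    simp only [relVel, inner_sub_left, sub_mul]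
    exact (integral_sub hbv hwv).symm
  have hcoercive : (μ - S.alpha1 (n + 1) / 2) * l2sq (S.dom (n + 1)) v ≤
      (∫ x in S.dom (n + 1), S.c (S.time (n + 1)) x * v x ^ 2) - 1 / 2 * ∫ x in S.dom (n + 1),
        (divergence (S.b (S.time (n + 1))) x - divergence (S.w (n + 1)) x) * v x ^ 2 := by
    rw [l2sq, ← integral_const_mul, ← integral_const_mul, ← integral_sub hcv hdiv]
    refine integral_mono_ae (hv2.integrable_sq.const_mul _) (hcv.sub hdiv) ?_
    filter_upwards [hS.le_reaction, ae_abs_le_linfty_toReal (h.memLp_divergence_w hn)]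
      with x hreaction hw
    have hw' : -S.alpha1 (n + 1) ≤ divergence (S.w (n + 1)) x := (abs_le.1 hw).1
    linear_combination v x ^ 2 * (hreaction + 1 / 2 * hw')
  simp only [mul_assoc (S.c _ _), ← sq]
  linarith [hv.integral_inner_relVel_gradient_mul h hn hb]

theorem mul_l2sq_laplacian_le (hcinv : S.IsInverseConst cinv) (heps : 0 ≤ S.eps)
    (hn : n ∈ Finset.Icc 1 S.N) (hS : S.StableAt μ cinv n) (hσ : σ ∈ S.mesh.cells)
    (hv : S.InVh n v) :
    S.δ n σ * S.eps ^ 2 * l2sq (S.cell n σ) (Laplacian.laplacian v) ≤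
      S.eps / 2 * ∫ x in S.cell n σ, ‖gradient v x‖ ^ 2 := by
  have hinv := hcinv.2 n hn σ hσ v hv
  have hδ := hS.δ_diffusion_le σ hσ
  have hδ₀ := hS.δ_nonneg σ hσ
  set D := Metric.diam (S.cell n σ)
  set G := ∫ x in S.cell n σ, ‖gradient v x‖ ^ 2
  have hG : 0 ≤ G := integral_nonneg fun _ => sq_nonneg _
  have hsq : l2sq (S.cell n σ) (Laplacian.laplacian v) ≤ (cinv * D⁻¹) ^ 2 * G := by
    have := pow_le_pow_left₀ (Real.sqrt_nonneg _) hinv 2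
    rwa [Real.sq_sqrt (l2sq_nonneg _ _), mul_pow, Real.sq_sqrt hG] at this
  have hD : (D * D⁻¹) ^ 2 ≤ 1 := pow_le_one₀ (by positivity) mul_inv_le_one
  calc S.δ n σ * S.eps ^ 2 * l2sq (S.cell n σ) (Laplacian.laplacian v)
      ≤ S.δ n σ * S.eps ^ 2 * ((cinv * D⁻¹) ^ 2 * G) := by gcongr
    _ = S.δ n σ * (2 * S.eps * cinv ^ 2) * (S.eps / 2 * D⁻¹ ^ 2 * G) := by ring
    _ ≤ D ^ 2 * (S.eps / 2 * D⁻¹ ^ 2 * G) := by gcongr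
    _ = (D * D⁻¹) ^ 2 * (S.eps / 2 * G) := by ring
    _ ≤ S.eps / 2 * G := mul_le_of_le_one_left (by positivity) hD

theorem stabilization_cell_ge (h : S.Admissible) (hcinv : S.IsInverseConst cinv)
    (heps : 0 ≤ S.eps) (hn : n < S.N) (hS : S.StableAt μ cinv (n + 1)) (hσ : σ ∈ S.mesh.cells)
    (hv : S.InVh (n + 1) v) :
    1 / 4 * (S.δ (n + 1) σ * l2sq (S.cell (n + 1) σ)
          fun x => inner ℝ (S.relVel (n + 1) x) (gradient v x)) -
        S.eps / 2 * (∫ x in S.cell (n + 1) σ, ‖gradient v x‖ ^ 2) -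
        μ / 2 * l2sq (S.cell (n + 1) σ) v -
        S.dt / 4 * l2sq (S.cell (n + 1) σ) (S.f (S.time (n + 1))) ≤
      S.δ (n + 1) σ * (∫ x in S.cell (n + 1) σ,
        (-S.eps * Laplacian.laplacian v x + inner ℝ (S.relVel (n + 1) x) (gradient v x) +
          S.c (S.time (n + 1)) x * v x) * inner ℝ (S.relVel (n + 1) x) (gradient v x)) -
      S.δ (n + 1) σ * ∫ x in S.cell (n + 1) σ,
        S.f (S.time (n + 1)) x * inner ℝ (S.relVel (n + 1) x) (gradient v x) := by
  obtain ⟨L, hb⟩ := hS.lipschitz_b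
  have hδ := hS.δ_nonneg σ hσ
  have hle := h.restrict_cell_le (n := n + 1) hn hσ
  have hcK := hS.memLp_c.mono_measure hle
  have hvK := (hv.memLp (q := 2) h hn).mono_measure hle
  have hZ := memLp_inner (r := 2) (h.memLp_relVel (q := ∞) hn hb)
    (hv.memLp_gradient (q := 2) h hn)
  have hres := mul_le_mul_of_nonneg_left (integral_residual_mul_sub_ge (ε := S.eps)
    ((hv.memLp_laplacian h hn).mono_measure hle) (hZ.mono_measure hle) (hvK.mul' hcK)
    (hS.memLp_f.mono_measure hle)) hδ
  have hdiffusion := mul_l2sq_laplacian_le hcinv heps (Finset.mem_Icc.2 ⟨by lia, hn⟩) hS hσ hv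
  have hreaction := mul_le_mul_of_nonneg_left (l2sq_mul_le hcK hvK) hδ
  have hreaction' := mul_le_mul_of_nonneg_right (hS.δ_reaction_le σ hσ)
    (l2sq_nonneg (S.cell (n + 1) σ) v)
  have hsource := mul_le_mul_of_nonneg_right (hS.δ_le_dt σ hσ)
    (l2sq_nonneg (S.cell (n + 1) σ) (S.f (S.time (n + 1))))
  simp only [l2sq] at *
  linarith

theorem stabilization_ge (h : S.Admissible) (hcinv : S.IsInverseConst cinv)
    (heps : 0 ≤ S.eps) (hn : n < S.N) (hS : S.StableAt μ cinv (n + 1))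
    (hv : S.InVh (n + 1) v) :
    1 / 4 * (∑ σ ∈ S.mesh.cells, S.δ (n + 1) σ * l2sq (S.cell (n + 1) σ)
          fun x => inner ℝ (S.relVel (n + 1) x) (gradient v x)) -
        S.eps / 2 * (∫ x in S.dom (n + 1), ‖gradient v x‖ ^ 2) -
        μ / 2 * l2sq (S.dom (n + 1)) v -
        S.dt / 4 * l2sq (S.dom (n + 1)) (S.f (S.time (n + 1))) ≤
      (∑ σ ∈ S.mesh.cells, S.δ (n + 1) σ * ∫ x in S.cell (n + 1) σ,
        (-S.eps * Laplacian.laplacian v x + inner ℝ (S.relVel (n + 1) x) (gradient v x) +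
          S.c (S.time (n + 1)) x * v x) * inner ℝ (S.relVel (n + 1) x) (gradient v x)) -
      ∑ σ ∈ S.mesh.cells, S.δ (n + 1) σ * ∫ x in S.cell (n + 1) σ,
        S.f (S.time (n + 1)) x * inner ℝ (S.relVel (n + 1) x) (gradient v x) := by
  rw [l2sq, l2sq, h.setIntegral_dom_eq_sum hn (hv.memLp h hn).integrable_sq,
    h.setIntegral_dom_eq_sum hn hS.memLp_f.integrable_sq,
    h.setIntegral_dom_eq_sum hn (hv.memLp_gradient h hn).norm.integrable_sq]
  simp only [Finset.mul_sum, ← Finset.sum_sub_distrib]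
  exact Finset.sum_le_sum fun σ hσ => stabilization_cell_ge h hcinv heps hn hS hσ hv

theorem IsSolution.energy_step {u : ℕ → E d → ℝ} (hu : S.IsSolution u) (h : S.Admissible)
    (heps : 0 ≤ S.eps) (hn : n < S.N) (hμ : 0 < μ) (hcinv : S.IsInverseConst cinv)
    (hS : S.StableAt μ cinv (n + 1)) :
    l2sq (S.dom (n + 1)) (u (n + 1)) + S.dt / 2 * S.supgNormSq μ (n + 1) (u (n + 1)) ≤
      (1 + S.dt * S.alpha2 n) * l2sq (S.dom n) (u n) +
        S.dt * ((2 / μ + S.dt / 2) * l2sq (S.dom (n + 1)) (S.f (S.time (n + 1)))) +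
        S.dt * S.alpha1 (n + 1) * l2sq (S.dom (n + 1)) (u (n + 1)) := by
  have hdt := h.dt_pos
  have hv := hu.1 (n + 1) hn
  have hv2 := hv.memLp (q := 2) h hn
  have hscheme := hu.2 n hn (u (n + 1)) hv
  have htime := integral_sq_sub_integral_sq_div_le hdt hv2 ((hu.1 n hn.le).memLp_transfer h hn)
  have htransfer := (hu.1 n hn.le).l2sq_transfer_le h hn
  have hconvection := hv.convection_reaction_ge h hn hS
  have hstabilization := stabilization_ge h hcinv heps hn hS hv
  have hsource := integral_mul_le_of_memLp_two hμ hS.memLp_f hv2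
  have hdiffusion : 0 ≤ S.eps * ∫ x in S.dom (n + 1), ‖gradient (u (n + 1)) x‖ ^ 2 :=
    mul_nonneg heps (integral_nonneg fun _ => sq_nonneg _)
  simp only [aSUPG, real_inner_self_eq_norm_sq] at hscheme
  have hbalance : (l2sq (S.dom (n + 1)) (u (n + 1)) -
      l2sq (S.dom (n + 1)) fun x => u n (S.transfer (n + 1) n x)) / (2 * S.dt) ≤
        (1 / μ + S.dt / 4) * l2sq (S.dom (n + 1)) (S.f (S.time (n + 1))) +
          S.alpha1 (n + 1) / 2 * l2sq (S.dom (n + 1)) (u (n + 1)) -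
          1 / 4 * S.supgNormSq μ (n + 1) (u (n + 1)) := by
    simp only [supgNormSq, l2sq] at *
    linarith
  rw [div_le_iff₀ (by positivity)] at hbalance
  linear_combination hbalance + htransfer

end Scheme

/-! ### Summation over the time steps -/

namespace Scheme

variable {d : ℕ} {S : Scheme d} {μ cinv : ℝ} {u : ℕ → E d → ℝ} {n : ℕ}

/-- The quantity `(1 + Δt α₂^n) ‖u^n‖² + (Δt / 2) ∑_{i=1}^n |||u^i|||²` to which the discrete
Gronwall inequality is applied. -/
noncomputable def accumulatedEnergy (S : Scheme d) (μ : ℝ) (u : ℕ → E d → ℝ) (n : ℕ) : ℝ :=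
  (1 + S.dt * S.alpha2 n) * l2sq (S.dom n) (u n) +
    S.dt / 2 * ∑ i ∈ Finset.Icc 1 n, S.supgNormSq μ i (u i)

theorem accumulatedEnergy_zero : S.accumulatedEnergy μ u 0 =
    (1 + S.dt * S.alpha2 0) * l2sq (S.dom 0) (u 0) := by
  simp [accumulatedEnergy]

theorem l2sq_add_sum_supgNormSq_le_accumulatedEnergy (hdt : 0 ≤ S.dt) :
    l2sq (S.dom n) (u n) + S.dt / 2 * ∑ i ∈ Finset.Icc 1 n, S.supgNormSq μ i (u i) ≤
      S.accumulatedEnergy μ u n := by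
  have := mul_nonneg (mul_nonneg hdt (S.alpha2_nonneg n)) (l2sq_nonneg (S.dom n) (u n))
  rw [accumulatedEnergy]
  linarith

theorem l2sq_le_accumulatedEnergy (hdt : 0 ≤ S.dt) (hμ : 0 ≤ μ) (heps : 0 ≤ S.eps)
    (hδ : ∀ i ∈ Finset.Icc 1 n, ∀ σ ∈ S.mesh.cells, 0 ≤ S.δ i σ) :
    l2sq (S.dom n) (u n) ≤ S.accumulatedEnergy μ u n :=
  le_trans (le_add_of_nonneg_right (mul_nonneg (by positivity)
    (Finset.sum_nonneg fun i hi => supgNormSq_nonneg hμ heps (hδ i hi) _)))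
    (l2sq_add_sum_supgNormSq_le_accumulatedEnergy hdt)

theorem IsSolution.accumulatedEnergy_succ_le (hu : S.IsSolution u) (h : S.Admissible)
    (heps : 0 ≤ S.eps) (hn : n < S.N) (hμ : 0 < μ) (hcinv : S.IsInverseConst cinv)
    (hS : ∀ i ∈ Finset.Icc 1 (n + 1), S.StableAt μ cinv i) :
    S.accumulatedEnergy μ u (n + 1) ≤ S.accumulatedEnergy μ u n +
        S.dt * ((2 / μ + S.dt / 2) * l2sq (S.dom (n + 1)) (S.f (S.time (n + 1)))) +
        S.dt * (S.alpha1 (n + 1) + S.alpha2 (n + 1)) * S.accumulatedEnergy μ u (n + 1) := by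
  have hstep := hu.energy_step h heps hn hμ hcinv (hS (n + 1) (by simp))
  have hrate : 0 ≤ S.dt * (S.alpha1 (n + 1) + S.alpha2 (n + 1)) :=
    mul_nonneg h.dt_pos.le (add_nonneg (S.alpha1_nonneg _) (S.alpha2_nonneg _))
  have hgrowth := mul_le_mul_of_nonneg_left (l2sq_le_accumulatedEnergy (u := u) h.dt_pos.le hμ.le
    heps fun i hi => (hS i hi).δ_nonneg) hrate
  have hsum := Finset.sum_Icc_succ_top (Nat.le_add_left 1 n) fun i => S.supgNormSq μ i (u i)
  simp only [accumulatedEnergy, hsum] at hgrowth ⊢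
  linarith

end Scheme

end ALESUPG

theorem mainTheorem1_general {d : ℕ} (S : ALESUPG.Scheme d) (h : S.Admissible) (heps : 0 ≤ S.eps)
    (μ : ℝ) (hμ : 0 < μ) (cinv : ℝ) (hcinv : S.IsInverseConst cinv)
    (u : ℕ → ALESUPG.E d → ℝ) (hu : S.IsSolution u) (n : ℕ) (hn : n < S.N)
    (hS : ∀ i ∈ Finset.Icc 1 (n + 1), S.StableAt μ cinv i)
    (hdt : ∀ i ∈ Finset.Icc 1 (n + 1), S.dt * (S.alpha1 i + S.alpha2 i) < 1) :
    ALESUPG.l2sq (S.dom (n + 1)) (u (n + 1)) +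
        S.dt / 2 * ∑ i ∈ Finset.Icc 1 (n + 1), S.supgNormSq μ i (u i) ≤
      ((1 + S.dt * S.alpha2 0) * ALESUPG.l2sq (S.dom 0) (u 0) +
          S.dt * ∑ i ∈ Finset.Icc 1 (n + 1),
            (2 / μ + S.dt / 2) * ALESUPG.l2sq (S.dom i) (S.f (S.time i))) *
        Real.exp (S.dt * ∑ i ∈ Finset.Icc 1 (n + 1),
          (S.alpha1 i + S.alpha2 i) / (1 - S.dt * (S.alpha1 i + S.alpha2 i))) := by
  have hτ := h.dt_pos
  refine (ALESUPG.Scheme.l2sq_add_sum_supgNormSq_le_accumulatedEnergy hτ.le).trans ?_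
  simp only [← ALESUPG.Scheme.accumulatedEnergy_zero (μ := μ), Finset.mul_sum (a := S.dt),
    ← mul_div_assoc (a := S.dt)]
  refine ALESUPG.implicit_discrete_gronwall ?_ (fun i _ => ?_) (fun i _ => ?_) hdt fun i hi => ?_
  · exact (ALESUPG.l2sq_nonneg _ _).trans
      (ALESUPG.Scheme.l2sq_le_accumulatedEnergy hτ.le hμ.le heps (by simp))
  · exact mul_nonneg hτ.le (mul_nonneg (by positivity) (ALESUPG.l2sq_nonneg _ _))
  · exact mul_nonneg hτ.le (add_nonneg (S.alpha1_nonneg i) (S.alpha2_nonneg i))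
  · exact hu.accumulatedEnergy_succ_le h heps (by lia) hμ hcinv fun j hj =>
      hS j (Finset.Icc_subset_Icc_right (by lia) hj)

theorem mainTheorem1 {d : ℕ} (hd : d = 2 ∨ d = 3) (S : ALESUPG.Scheme d)
    (hT : 0 < S.T) (hN : 0 < S.N) (heps : 0 < S.eps)
    -- the ALE mappings are piecewise affine, and bijective onto the domains at all times
    (hA : ∀ n ≤ S.N, S.mesh.IsP1Map (S.A (S.time n)))
    (hAinj : ∀ n < S.N, ∀ t ∈ Set.Icc (S.time n) (S.time (n + 1)),
      Set.InjOn (S.interp n t) S.mesh.region)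
    -- regularity of the coefficients and of the source term
    (hb : ∀ n ∈ Finset.Icc 1 S.N, ∃ L : NNReal, LipschitzOnWith L (S.b (S.time n)) (S.dom n))
    (hc : ∀ n ∈ Finset.Icc 1 S.N,
      MeasureTheory.MemLp (S.c (S.time n)) ⊤ (MeasureTheory.volume.restrict (S.dom n)))
    (hf : ∀ n ∈ Finset.Icc 1 S.N,
      MeasureTheory.MemLp (S.f (S.time n)) 2 (MeasureTheory.volume.restrict (S.dom n)))
    -- `c - ∇ · b / 2 ≥ μ > 0`
    (μ : ℝ) (hμ : 0 < μ)
    (hpos : ∀ n ∈ Finset.Icc 1 S.N, ∀ᵐ x ∂(MeasureTheory.volume.restrict (S.dom n)),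
      μ ≤ S.c (S.time n) x - 1 / 2 * ALESUPG.divergence (S.b (S.time n)) x)
    -- the bounds on the stabilization parameters, free of division by zero
    (cinv : ℝ) (hcinv : S.IsInverseConst cinv)
    (hδ0 : ∀ n ∈ Finset.Icc 1 S.N, ∀ σ ∈ S.mesh.cells, 0 ≤ S.δ n σ)
    (hδc : ∀ n ∈ Finset.Icc 1 S.N, ∀ σ ∈ S.mesh.cells,
      S.δ n σ * (2 * (ALESUPG.linfty (S.cell n σ) (S.c (S.time n))).toReal ^ 2) ≤ μ)
    (hδh : ∀ n ∈ Finset.Icc 1 S.N, ∀ σ ∈ S.mesh.cells,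
      S.δ n σ ≤ Metric.diam (S.cell n σ) ^ 2 / (2 * S.eps * cinv ^ 2))
    (hδt : ∀ n ∈ Finset.Icc 1 S.N, ∀ σ ∈ S.mesh.cells, S.δ n σ ≤ S.dt / 4)
    (u : ℕ → ALESUPG.E d → ℝ) (hu : S.IsSolution u)
    (n : ℕ) (hn : n < S.N)
    (hdt : ∀ i ∈ Finset.Icc 1 (n + 1), S.dt * (S.alpha1 i + S.alpha2 i) < 1) :
    ALESUPG.l2sq (S.dom (n + 1)) (u (n + 1)) +
        S.dt / 2 * ∑ i ∈ Finset.Icc 1 (n + 1), S.supgNormSq μ i (u i) ≤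
      ((1 + S.dt * S.alpha2 0) * ALESUPG.l2sq (S.dom 0) (u 0) +
          S.dt * ∑ i ∈ Finset.Icc 1 (n + 1),
            (2 / μ + S.dt / 2) * ALESUPG.l2sq (S.dom i) (S.f (S.time i))) *
        Real.exp (S.dt * ∑ i ∈ Finset.Icc 1 (n + 1),
          (S.alpha1 i + S.alpha2 i) / (1 - S.dt * (S.alpha1 i + S.alpha2 i))) := by
  refine mainTheorem1_general S ⟨div_pos hT (Nat.cast_pos.2 hN), hA, hAinj⟩ heps.le μ hμ cinv
    hcinv u hu n hn (fun i hi => ?_) hdt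
  replace hi := Finset.Icc_subset_Icc_right hn hi
  have hcinv₀ := hcinv.1
  exact ⟨hb i hi, hc i hi, hf i hi, hpos i hi, hδ0 i hi, hδc i hi,
    fun σ hσ => (le_div_iff₀ (by positivity)).1 (hδh i hi σ hσ), hδt i hi⟩
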